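/- Setting. A central encoder serves $N_B$ base stations (BSs); BS $i$ has $n_{B,i}$ antennas, $n_B=\sum_i n_{B,i}$, and is reached by a backhaul link of capacity $C_i$ bits per channel use. Let $\mathbf s\sim\mathcal{CN}(\mathbf 0,\mathbf I)$ be the vector of all encoded data symbols, $\mathbf A$ a complex precoding matrix with $n_B$ rows and as many columns as $\mathbf s$ has entries, $\tilde{\mathbf x}=\mathbf A\mathbf s$, and let $$\mathbf x=[\mathbf x_1^\dagger,\ldots,\mathbf x_{N_B}^\dagger]^\dagger=\mathbf A\mathbf s+\mathbf q ,\qquad \mathbf q\sim\mathcal{CN}(\mathbf 0,\mathbf\Omega)\ \text{ independent of } \mathbf s ,\qquad \mathbf x_i\in\mathbb C^{n_{B,i}},$$ be the Gaussian test channel, with $\mathbf\Omega\succ\mathbf 0$ an $n_B\times n_B$ matrix with blocks $\mathbf\Omega_{i,j}$. Let $\mathbf E_i\in\mathbb C^{n_B\times n_{B,i}}$ have an identity block in the rows of BS $i$ and zeros elsewhere; for $\mathcal S\subseteq\{1,\ldots,N_B\}$, let $\mathbf E_{\mathcal S}$ be the horizontal stacking of the $\mathbf E_i$, $i\in\mathcal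 S$, and let $\mathbf x_{\mathcal S}=(\mathbf x_i)_{i\in\mathcal S}$. Logarithms are in base two and $h$ is differential entropy. Reliable transfer. A backhaul code of blocklength $n$ consists of codebooks $\mathcal C_i$ of at most $2^{nC_i}$ codewords in $(\mathbb C^{n_{B,i}})^n$, one for each BS, and a (measurable) joint encoder that maps the block $\tilde{\mathbf x}^n$ to one index per BS; BS $i$ outputs the codeword of $\mathcal C_i$ with the received index, giving $\mathbf x_i^n$. Two sequences $(\tilde{\mathbf x}^n,\mathbf x^n)$ are $(\Delta,\varepsilon)$-jointly typical if the normalized histogram of the pairs $(\tilde{\mathbf x}_t,\mathbf x_t)$, $t=1,\ldots,n$, with step size $\Delta$ in every real coordinate, deviates from the cell probabilities of the law of $(\tilde{\mathbf x},\mathbf x)$ under the test channel by at most $\varepsilon$ in $\ell^1$ distance. The signals $\mathbf x_1,\ldots,\mathbf x_{N_B}$ obtained via the test channel can be reliably transferred to the BSs on the backhaul links if for all $\Delta,\varepsilon,\delta>0$ and all sufficiently large $n$ there is a backhaul code of blocklength $n$ such that, for $\tilde{\mathbf x}^n$ i.i.d. with the law of $\mathbf A\mathbf s$, the output $(\mathbf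 x_1^n,\ldots,\mathbf x_{N_B}^n)$ is $(\Delta,\varepsilon)$-jointly typical with $\tilde{\mathbf x}^n$ with probability at least $1-\delta$. Lemma. For every $\mathcal S\subseteq\{1,\ldots,N_B\}$ the differential entropies below exist, are finite, and satisfy $$g_{\mathcal S}(\mathbf A,\mathbf\Omega)\triangleq\sum_{i\in\mathcal S}h(\mathbf x_i)-h(\mathbf x_{\mathcal S}\mid\tilde{\mathbf x})=\sum_{i\in\mathcal S}\log\det\left(\mathbf E_i^\dagger\mathbf A\mathbf A^\dagger\mathbf E_i+\mathbf\Omega_{i,i}\right)-\log\det\left(\mathbf E_{\mathcal S}^\dagger\mathbf\Omega\mathbf E_{\mathcal S}\right).$$ Moreover, the signals $\mathbf x_1,\ldots,\mathbf x_{N_B}$ obtained via the test channel can be reliably transferred to the BSs on the backhaul links if $$g_{\mathcal S}(\mathbf A,\mathbf\Omega)\le\sum_{i\in\mathcal S}C_i\qquad\text{for all }\mathcal S\subseteq\{1,\ldots,N_B\}.$$ -/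

import Mathlib

open MeasureTheory ProbabilityTheory
open scoped Matrix ComplexOrder

namespace CloudRAN

noncomputable section

/-! ## Circularly symmetric complex Gaussian vectors -/

/-- `CN(0, 1)` on `ℂ`: real and imaginary parts are independent `N(0, 1/2)`. -/
def stdComplexNormal : Measure ℂ :=
  ((gaussianReal 0 (1 / 2)).prod (gaussianReal 0 (1 / 2))).map fun p => (⟨p.1, p.2⟩ : ℂ)

/-- `CN(0, I)` on `ℂ^ι`: independent `CN(0, 1)` coordinates. -/
def stdCN (ι : Type) [Fintype ι] : Measure (ι → ℂ) :=
  Measure.pi fun _ => stdComplexNormal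

open scoped MatrixOrder Matrix.Norms.L2Operator in
/-- `CN(0, R)` for a positive semidefinite `R`: the law of `R^{1/2} w` with `w ~ CN(0, I)`. -/
def CN {ι : Type} [Fintype ι] [DecidableEq ι] (R : Matrix ι ι ℂ) : Measure (ι → ℂ) :=
  (stdCN ι).map fun w => CFC.sqrt R *ᵥ w

theorem measurable_complex_mk : Measurable fun p : ℝ × ℝ => (⟨p.1, p.2⟩ : ℂ) :=
  Complex.measurableEquivRealProd.symm.measurable

instance : IsProbabilityMeasure stdComplexNormal :=
  Measure.isProbabilityMeasure_map measurable_complex_mk.aemeasurable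

instance (ι : Type) [Fintype ι] : IsProbabilityMeasure (stdCN ι) := by
  unfold stdCN; infer_instance

theorem measurable_mulVec {ι κ : Type} [Fintype ι] [Fintype κ] (B : Matrix ι κ ℂ) :
    Measurable fun w : κ → ℂ => B *ᵥ w := by
  refine measurable_pi_lambda _ fun i => ?_
  simp only [Matrix.mulVec, dotProduct]
  fun_prop

instance {ι : Type} [Fintype ι] [DecidableEq ι] (R : Matrix ι ι ℂ) :
    IsProbabilityMeasure (CN R) :=
  Measure.isProbabilityMeasure_map (measurable_mulVec _).aemeasurable

/-! ## Differential entropy (in bits) -/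

section Entropy

variable {ι : Type} [Fintype ι]

/-- The probability density of `μ` with respect to Lebesgue measure on `ℂ^ι`. -/
def density (μ : Measure (ι → ℂ)) (z : ι → ℂ) : ℝ := (μ.rnDeriv volume z).toReal

/-- Differential entropy `-∫ f log₂ f` of a law on `ℂ^ι` with density `f`. -/
def diffEntropy (μ : Measure (ι → ℂ)) : ℝ :=
  -∫ z, density μ z * Real.logb 2 (density μ z)

/-- The differential entropy of `μ` exists and is finite. -/
def HasDiffEntropy (μ : Measure (ι → ℂ)) : Prop :=
  μ ≪ volume ∧ Integrable (fun z => density μ z * Real.logb 2 (density μ z)) volume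

variable {Ω₀ E : Type} [MeasurableSpace Ω₀] [MeasurableSpace E]

/-- Conditional differential entropy `h(X | Y) = ∫ h(X | Y = y) dP_Y(y)`. -/
def condDiffEntropy (X : Ω₀ → ι → ℂ) (Y : Ω₀ → E) (P : Measure Ω₀) [IsFiniteMeasure P] : ℝ :=
  ∫ y, diffEntropy (condDistrib X Y P y) ∂(P.map Y)

/-- The conditional differential entropy `h(X | Y)` exists and is finite. -/
def HasCondDiffEntropy (X : Ω₀ → ι → ℂ) (Y : Ω₀ → E) (P : Measure Ω₀) [IsFiniteMeasure P] :
    Prop :=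
  (∀ᵐ y ∂(P.map Y), HasDiffEntropy (condDistrib X Y P y)) ∧
    Integrable (fun y => diffEntropy (condDistrib X Y P y)) (P.map Y)

end Entropy

/-! ## Precoding and the Gaussian test channel -/

section Model

variable {NB NM : ℕ} (nB : Fin NB → ℕ) (r : Fin NM → ℕ)

/-- All transmit antennas: antenna `a` of base station `i` is `⟨i, a⟩`. -/
abbrev Ant : Type := Σ i : Fin NB, Fin (nB i)

/-- The antennas of the base stations in `S`. -/
abbrev AntOf (S : Finset (Fin NB)) : Type := Σ i : {i // i ∈ S}, Fin (nB i.1)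

/-- All data streams: stream `b` intended for mobile station `k` is `⟨k, b⟩`. -/
abbrev Streams : Type := Σ k : Fin NM, Fin (r k)

/-- `E_i`: zero except for an identity block in the rows belonging to base station `i`. -/
def selMat (i : Fin NB) : Matrix (Ant nB) (Fin (nB i)) ℂ :=
  fun p a => if p = ⟨i, a⟩ then 1 else 0

/-- `E_S`: the matrices `E_i`, `i ∈ S`, stacked horizontally. -/
def selMatOf (S : Finset (Fin NB)) : Matrix (Ant nB) (AntOf nB S) ℂ :=
  fun p q => selMat nB q.1.1 p q.2

variable {nB r}

/-- The block `Ω_{i,j}`. -/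
def block (Ω : Matrix (Ant nB) (Ant nB) ℂ) (i j : Fin NB) : Matrix (Fin (nB i)) (Fin (nB j)) ℂ :=
  fun a b => Ω ⟨i, a⟩ ⟨j, b⟩

/-- Joint law of `(s, q)`: independent, `s ~ CN(0, I)` and `q ~ CN(0, Ω)`. -/
def sqLaw (r : Fin NM → ℕ) (Ω : Matrix (Ant nB) (Ant nB) ℂ) :
    Measure ((Streams r → ℂ) × (Ant nB → ℂ)) :=
  (stdCN (Streams r)).prod (CN Ω)

instance (Ω : Matrix (Ant nB) (Ant nB) ℂ) : IsProbabilityMeasure (sqLaw r Ω) := by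
  unfold sqLaw; infer_instance

variable (A : Matrix (Ant nB) (Streams r) ℂ) (Ω : Matrix (Ant nB) (Ant nB) ℂ)

/-- The precoded signal `x̃ = A s`, as a random vector of `(s, q)`. -/
def precoded (ω : (Streams r → ℂ) × (Ant nB → ℂ)) : Ant nB → ℂ := A *ᵥ ω.1

/-- The compressed signal `x = A s + q`, as a random vector of `(s, q)`. -/
def compressed (ω : (Streams r → ℂ) × (Ant nB → ℂ)) : Ant nB → ℂ := A *ᵥ ω.1 + ω.2

/-- The compressed signal `x_i` of base station `i`. -/
def compressedAt (i : Fin NB) (ω : (Streams r → ℂ) × (Ant nB → ℂ)) : Fin (nB i) → ℂ :=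
  fun a => compressed A ω ⟨i, a⟩

/-- The compressed signals `x_S` of the base stations in `S`. -/
def compressedOf (S : Finset (Fin NB)) (ω : (Streams r → ℂ) × (Ant nB → ℂ)) : AntOf nB S → ℂ :=
  fun p => compressed A ω ⟨p.1.1, p.2⟩

/-- The joint law `p(x̃, x_1, …, x_{N_B})` specified by the test channel. -/
def testChannelLaw : Measure ((Ant nB → ℂ) × (Ant nB → ℂ)) :=
  (sqLaw r Ω).map fun ω => (precoded A ω, compressed A ω)

/-- The law of the precoded signal `x̃ = A s`. -/
def sourceLaw : Measure (Ant nB → ℂ) := (stdCN (Streams r)).map fun s => A *ᵥ s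

/-- `g_S(A, Ω) = ∑_{i ∈ S} h(x_i) - h(x_S | x̃)`. -/
def entropyRate (S : Finset (Fin NB)) : ℝ :=
  ∑ i ∈ S, diffEntropy ((sqLaw r Ω).map (compressedAt A i)) -
    condDiffEntropy (compressedOf A S) (precoded A) (sqLaw r Ω)

/-- The entropies that occur in `g_S(A, Ω)` exist and are finite. -/
def EntropyRateDefined (S : Finset (Fin NB)) : Prop :=
  (∀ i ∈ S, HasDiffEntropy ((sqLaw r Ω).map (compressedAt A i))) ∧
    HasCondDiffEntropy (compressedOf A S) (precoded A) (sqLaw r Ω)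

/-- `log₂ det M`, for a Hermitian positive definite `M` (whose determinant is real, positive). -/
def logDet {ι : Type} [Fintype ι] [DecidableEq ι] (M : Matrix ι ι ℂ) : ℝ :=
  Real.logb 2 M.det.re

/-- `∑_{i ∈ S} log det(E_i† A A† E_i + Ω_{i,i}) - log det(E_S† Ω E_S)`. -/
def logDetRate (S : Finset (Fin NB)) : ℝ :=
  ∑ i ∈ S, logDet ((selMat nB i)ᴴ * A * Aᴴ * selMat nB i + block Ω i i) -
    logDet ((selMatOf nB S)ᴴ * Ω * selMatOf nB S)

end Model

/-! ## Joint typicality: histograms of step size `Δ` -/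

section Typicality

variable {ι : Type} [Fintype ι] {n : ℕ}

/-- The histogram cell of `z`: real and imaginary parts of all coordinates, quantized with
step size `Δ`. -/
def cell (Δ : ℝ) (z : ι → ℂ) : ι → ℤ × ℤ := fun a => (⌊(z a).re / Δ⌋, ⌊(z a).im / Δ⌋)

/-- The histogram cell of a pair of vectors. -/
def cell₂ (Δ : ℝ) (p : (ι → ℂ) × (ι → ℂ)) : (ι → ℤ × ℤ) × (ι → ℤ × ℤ) :=
  (cell Δ p.1, cell Δ p.2)

/-- Empirical frequency of the cell `c` in the pair of sequences `(u, v)`. -/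
def empFreq (Δ : ℝ) (u v : Fin n → ι → ℂ) (c : (ι → ℤ × ℤ) × (ι → ℤ × ℤ)) : ℝ :=
  (Nat.card {t : Fin n // cell₂ Δ (u t, v t) = c} : ℝ) / n

/-- The sequences `u`, `v` are jointly typical for the law `p`: the normalized histogram of
step size `Δ` of `(u, v)` deviates from that of `p` by at most `ε` in `ℓ¹` distance. -/
def JointlyTypical (p : Measure ((ι → ℂ) × (ι → ℂ))) (Δ ε : ℝ) (u v : Fin n → ι → ℂ) : Prop :=
  ∑' c, |empFreq Δ u v c - p.real {z | cell₂ Δ z = c}| ≤ ε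

end Typicality

/-! ## Reliable delivery over the backhaul links -/

section Delivery

variable {NB NM : ℕ} {nB : Fin NB → ℕ} {r : Fin NM → ℕ}

/-- A backhaul compression scheme of blocklength `n`. The central encoder, which sees the whole
block of precoded signals, jointly picks one index per base station; the `i`-th index takes at
most `2 ^ (n C_i)` values, and base station `i` outputs the codeword of its own codebook that the
index points to. -/
structure BackhaulCode (nB : Fin NB → ℕ) (C : Fin NB → ℝ) (n : ℕ) where
  /-- sizes of the codebooks -/
  size : Fin NB → ℕ
  size_le : ∀ i, (size i : ℝ) ≤ (2 : ℝ) ^ ((n : ℝ) * C i)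
  /-- the codebooks -/
  codebook : ∀ i, Fin (size i) → Fin n → Fin (nB i) → ℂ
  /-- the joint encoder -/
  enc : (Fin n → Ant nB → ℂ) → ∀ i, Fin (size i)
  measurable_enc : Measurable enc

/-- The signals `(x_1^n, …, x_{N_B}^n)` recovered by the base stations when the block of precoded
signals is `u`. -/
def BackhaulCode.output {C : Fin NB → ℝ} {n : ℕ} (c : BackhaulCode nB C n)
    (u : Fin n → Ant nB → ℂ) : Fin n → Ant nB → ℂ :=
  fun t p => c.codebook p.1 (c.enc u p.1) t p.2

/-- The signals `x_1, …, x_{N_B}` of the test channel `x = A s + q` can be reliably transferred to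
the base stations on backhaul links of capacities `C_i` bits per channel use: for `n` large, there
are codes for which the recovered signals are, with probability arbitrarily close to one, jointly
typical with the i.i.d. block `x̃^n` with respect to the law of the test channel. -/
def ReliablyTransferable (A : Matrix (Ant nB) (Streams r) ℂ) (Ω : Matrix (Ant nB) (Ant nB) ℂ)
    (C : Fin NB → ℝ) : Prop :=
  ∀ Δ > 0, ∀ ε > 0, ∀ δ > 0, ∃ n₀ : ℕ, ∀ n ≥ n₀, ∃ c : BackhaulCode nB C n,
    1 - δ ≤ (Measure.pi fun _ : Fin n => sourceLaw A).real
      {u | JointlyTypical (testChannelLaw A Ω) Δ ε u (c.output u)}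

end Delivery

end

end CloudRAN

/-!
The entropy formula is a Gaussian computation. Each `x_i` is `CN(0, E_i†(A A† + Ω)E_i)`, and given
`x̃ = y` the vector `x_S` is Gaussian with mean the restriction of `y` and covariance
`E_S† Ω E_S` (`condDistrib_compressedOf`). The entropy of a Gaussian vector on `ℂ^d` is
`d log₂(π e)` plus the log-determinant of its covariance (`diffEntropy_CN`), and the terms
`d log₂(π e)` cancel in `g_S` because the antennas of `S` are counted once on either side
(`entropyRateDefined_and_eq`).

The transfer statement is a mutual covering lemma. Let `Q` be the product of the marginal laws of
`x_1, …, x_N`, let `μ` be the law of `x̃`, and let `f` be the density of the test channel with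
respect to `μ × Q`. Draw all codewords independently from the marginals, and count the codeword
tuples that are jointly good with a source block, each weighted by `f`. Two tuples which agree
exactly on the base stations in `T` contribute to the second moment through the `T`-marginal of
`f`, whose exponential growth rate along typical blocks is `log 2 · g_T`, against
`∏_{i ∈ T} 2^{n C_i}` codewords. So if `g_T < ∑_{i ∈ T} C_i` for all nonempty `T`, the
Cauchy–Schwarz inequality shows that some good tuple exists with probability tending to one
(`one_shot_covering`, `sum_agreement_le`, `block_covering`, `tendsto_covering_bound`).

Equality `g_T = ∑_{i ∈ T} C_i` is allowed. To recover strict inequalities, the test channel `P` is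
replaced by the mixture `l P + (1 - l)(μ × Q)` with `l < 1` close to one: this moves the cell
probabilities by at most `2(1 - l)` in `ℓ¹`, and by convexity of `x log x` it multiplies every
rate by at most `l`. This does not help if `∑_{i ∈ T} C_i = 0`, but then the relative entropy of
the `T`-marginal vanishes, so this marginal is the product law, its density is one, and such sets
are harmless. All this is `mutual_covering`.

To apply it to the test channel, the `T`-marginals are represented without conditioning: the
components of `x` outside `T` are replaced by independent copies. The resulting vector, given `x̃`,
is Gaussian with block covariance `mergedCov`, and the expectation of its log-density is
`log 2 · g_T(A, Ω)` (`integral_mergedLogDensity`).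
-/

namespace CloudRAN

open scoped ENNReal Topology
open Filter

/-! ### Products of measures and second-moment covering -/

theorem measurePreserving_zip {ι : Type*} [Fintype ι] {α β : ι → Type*}
    [∀ i, MeasurableSpace (α i)] [∀ i, MeasurableSpace (β i)]
    (μ : ∀ i, Measure (α i)) (ν : ∀ i, Measure (β i))
    [∀ i, IsProbabilityMeasure (μ i)] [∀ i, IsProbabilityMeasure (ν i)] :
    MeasurePreserving (fun (p : (∀ i, α i) × (∀ i, β i)) i => (p.1 i, p.2 i))
      ((Measure.pi μ).prod (Measure.pi ν)) (Measure.pi fun i => (μ i).prod (ν i)) := by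
  refine ⟨by fun_prop, ?_⟩
  refine (Measure.pi_eq_generateFrom (C := fun i => Set.image2 (· ×ˢ ·)
    {s : Set (α i) | MeasurableSet s} {t : Set (β i) | MeasurableSet t})
    (fun i => generateFrom_prod) (fun i => isPiSystem_prod)
    (fun i => (Measure.FiniteSpanningSetsIn.prod (μ i).toFiniteSpanningSetsIn
      (ν i).toFiniteSpanningSetsIn)) ?_).symm
  intro s hs
  choose a ha b hb hab using hs
  have hpre : (fun (p : (∀ i, α i) × (∀ i, β i)) i => (p.1 i, p.2 i)) ⁻¹' Set.univ.pi s =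
      Set.univ.pi a ×ˢ Set.univ.pi b := by
    ext p
    simp [Set.mem_pi, ← hab, forall_and]
  have hm : MeasurableSet (Set.univ.pi s) :=
    .univ_pi fun i => by rw [← hab]; exact (ha i).prod (hb i)
  rw [Measure.map_apply (by fun_prop) hm, hpre, Measure.prod_prod, Measure.pi_pi, Measure.pi_pi,
    ← Finset.prod_mul_distrib]
  exact Finset.prod_congr rfl fun i _ => by rw [← hab, Measure.prod_prod]

theorem lintegral_pi_prod {ι : Type*} [Fintype ι] {α : ι → Type*} [∀ i, MeasurableSpace (α i)]
    (μ : ∀ i, Measure (α i)) [∀ i, SigmaFinite (μ i)] {f : ∀ i, α i → ℝ≥0∞}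
    (hf : ∀ i, Measurable (f i)) :
    ∫⁻ x, ∏ i, f i (x i) ∂Measure.pi μ = ∏ i, ∫⁻ x, f i x ∂μ i := by
  classical
  have key : ∀ s : Finset ι, ∀ x : ∀ i, α i,
      (∫⋯∫⁻_s, (fun x => ∏ i ∈ s, f i (x i)) ∂μ) x = ∏ i ∈ s, ∫⁻ x, f i x ∂μ i := by
    intro s
    induction s using Finset.induction_on with
    | empty => intro x; simp
    | insert i s his ih =>
      intro x
      have hm : ∀ t : Finset ι, Measurable fun x : ∀ i, α i => ∏ i ∈ t, f i (x i) := fun t =>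
        Finset.measurable_prod _ fun j _ => (hf j).comp (measurable_pi_apply j)
      rw [lmarginal_insert _ (hm _) his, Finset.prod_insert his,
        ← lintegral_mul_const _ (hf i)]
      refine lintegral_congr fun a => ?_
      rw [← ih (Function.update x i a)]
      simp only [lmarginal, Finset.prod_insert his]
      rw [← lintegral_const_mul]
      · refine lintegral_congr fun y => ?_
        congr 2
        simp [Function.updateFinset, his]
      · exact (hm s).comp measurable_updateFinset
  by_cases hne : ∀ i, Nonempty (α i)
  swap
  · push Not at hne
    obtain ⟨i, hi⟩ := hne
    have : IsEmpty (∀ i, α i) := ⟨fun x => hi.false (x i)⟩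
    rw [lintegral_of_isEmpty]
    exact (Finset.prod_eq_zero (Finset.mem_univ i) (lintegral_of_isEmpty _ _)).symm
  rw [lintegral_eq_lmarginal_univ (fun i => (hne i).some)]
  exact key Finset.univ _

theorem pi_withDensity {ι : Type*} [Fintype ι] {α : ι → Type*} [∀ i, MeasurableSpace (α i)]
    (μ : ∀ i, Measure (α i)) [∀ i, SigmaFinite (μ i)] {f : ∀ i, α i → ℝ≥0∞}
    (hf : ∀ i, Measurable (f i)) [∀ i, SigmaFinite ((μ i).withDensity (f i))] :
    Measure.pi (fun i => (μ i).withDensity (f i)) =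
      (Measure.pi μ).withDensity fun x => ∏ i, f i (x i) := by
  refine Measure.pi_eq fun s hs => ?_
  rw [withDensity_apply _ (.univ_pi hs), ← lintegral_indicator (.univ_pi hs)]
  have : (Set.univ.pi s).indicator (fun x : ∀ i, α i => ∏ i, f i (x i)) =
      fun x => ∏ i, (s i).indicator (f i) (x i) := by
    ext x
    by_cases hx : x ∈ Set.univ.pi s
    · rw [Set.indicator_of_mem hx]
      exact Finset.prod_congr rfl fun i _ => by rw [Set.indicator_of_mem (hx i trivial)]
    · rw [Set.indicator_of_notMem hx]
      simp only [Set.mem_pi, Set.mem_univ, true_imp_iff, not_forall] at hx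
      obtain ⟨i, hi⟩ := hx
      exact (Finset.prod_eq_zero (Finset.mem_univ i) (Set.indicator_of_notMem hi _)).symm
  rw [this, lintegral_pi_prod μ fun i => (hf i).indicator (hs i)]
  exact Finset.prod_congr rfl fun i _ => by
    rw [withDensity_apply _ (hs i), lintegral_indicator (hs i)]

section OneShot

variable {𝒰 𝒳 𝒞 : Type*} [MeasurableSpace 𝒰] [MeasurableSpace 𝒳] [MeasurableSpace 𝒞]

/-- Second-moment covering bound. A random codebook `c ~ κ` has codewords `ev j c` of law `Q`, and a
pair of codewords is distributed as `(x, mg (T j j') (x, y))` with `x`, `y` independent of law `Q`,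
where `T j j'` records how much the two share. If the averages of `f` over the fresh part are at
most `K` on the good set `G`, then the weight of `G` controls from below the probability that
some codeword is good together with an independent source `u ~ μ`. -/
theorem one_shot_covering {μ : Measure 𝒰} {Q : Measure 𝒳} {κ : Measure 𝒞}
    [IsProbabilityMeasure μ] [IsProbabilityMeasure Q] [IsProbabilityMeasure κ]
    {J τ : Type*} [Fintype J] [Nonempty J] {ev : J → 𝒞 → 𝒳} (hev : ∀ j, Measurable (ev j))
    {mg : τ → 𝒳 × 𝒳 → 𝒳} (hmg : ∀ T, Measurable (mg T)) {T : J → J → τ}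
    (hpair : ∀ j j', κ.map (fun c => (ev j c, ev j' c)) =
      (Q.prod Q).map fun p => (p.1, mg (T j j') p))
    {f : 𝒰 × 𝒳 → ℝ≥0∞} (hf : Measurable f) (hf1 : ∫⁻ z, f z ∂μ.prod Q ≤ 1)
    {G : Set (𝒰 × 𝒳)} (hG : MeasurableSet G) {K : τ → ℝ≥0∞}
    (hK : ∀ t, ∀ z ∈ G, ∫⁻ y, f (z.1, mg t (z.2, y)) ∂Q ≤ K t) :
    (∫⁻ z in G, f z ∂μ.prod Q) ^ 2 ≤
      (μ.prod κ) {z | ∃ j, (z.1, ev j z.2) ∈ G} *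
        ((∑ j, ∑ j', K (T j j')) / (Fintype.card J : ℝ≥0∞) ^ 2) := by
  set w : 𝒰 × 𝒳 → ℝ≥0∞ := G.indicator f with hw
  have hwm : Measurable w := hf.indicator hG
  have hwint : ∫⁻ z, w z ∂μ.prod Q = ∫⁻ z in G, f z ∂μ.prod Q := lintegral_indicator hG _
  have hw1 : ∫⁻ z, w z ∂μ.prod Q ≤ 1 :=
    (lintegral_mono (Set.indicator_le_self _ _)).trans hf1
  set N : ℝ≥0∞ := (Fintype.card J : ℝ≥0∞) with hN
  have hN0 : N ≠ 0 := by simp [hN]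
  have hNt : N ≠ ∞ := by simp [hN]
  set W : 𝒰 × 𝒞 → ℝ≥0∞ := fun z => ∑ j, w (z.1, ev j z.2) with hW
  have hWm : Measurable W := by
    refine Finset.measurable_sum _ fun j _ => ?_
    exact hwm.comp (measurable_fst.prodMk ((hev j).comp measurable_snd))
  -- every codeword has law `Q`
  have hlaw : ∀ j, κ.map (ev j) = Q := by
    intro j
    have h := congrArg (Measure.map Prod.fst) (hpair j j)
    rw [Measure.map_map measurable_fst (by fun_prop),
      Measure.map_map measurable_fst (by fun_prop)] at h
    have h2 : (Prod.fst ∘ fun p : 𝒳 × 𝒳 => (p.1, mg (T j j) p)) = Prod.fst := rfl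
    rw [h2] at h
    exact h.trans (by simp)
  have hEW : ∫⁻ z, W z ∂μ.prod κ = N * ∫⁻ z, w z ∂μ.prod Q := by
    simp only [hW]
    rw [lintegral_finsetSum _ fun j _ => by
      exact hwm.comp (measurable_fst.prodMk ((hev j).comp measurable_snd))]
    have : ∀ j, ∫⁻ z, w (z.1, ev j z.2) ∂μ.prod κ = ∫⁻ z, w z ∂μ.prod Q := by
      intro j
      have hm : Measurable fun z : 𝒰 × 𝒞 => w (z.1, ev j z.2) :=
        hwm.comp (measurable_fst.prodMk ((hev j).comp measurable_snd))
      rw [lintegral_prod _ hm.aemeasurable, lintegral_prod _ hwm.aemeasurable]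
      refine lintegral_congr fun u => ?_
      have hmu : Measurable fun x => w (u, x) := hwm.comp measurable_prodMk_left
      rw [← hlaw j, lintegral_map hmu (hev j)]
    simp [this, hN]
  have hEW2 : ∫⁻ z, W z ^ 2 ∂μ.prod κ ≤ ∑ j, ∑ j', K (T j j') := by
    have hexp : ∀ z, W z ^ 2 = ∑ j, ∑ j', w (z.1, ev j z.2) * w (z.1, ev j' z.2) := by
      intro z
      rw [sq, hW, Finset.sum_mul_sum]
    have hmm : ∀ j j', Measurable fun z : 𝒰 × 𝒞 => w (z.1, ev j z.2) * w (z.1, ev j' z.2) :=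
      fun j j' => (hwm.comp (measurable_fst.prodMk ((hev j).comp measurable_snd))).mul
        (hwm.comp (measurable_fst.prodMk ((hev j').comp measurable_snd)))
    simp_rw [hexp]
    rw [lintegral_finsetSum _ fun j _ => Finset.measurable_sum _ fun j' _ => hmm j j']
    refine Finset.sum_le_sum fun j _ => ?_
    rw [lintegral_finsetSum _ fun j' _ => hmm j j']
    refine Finset.sum_le_sum fun j' _ => ?_
    rw [lintegral_prod _ (hmm j j').aemeasurable]
    calc ∫⁻ u, ∫⁻ c, w (u, ev j c) * w (u, ev j' c) ∂κ ∂μ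
        = ∫⁻ u, ∫⁻ x, ∫⁻ y, w (u, x) * w (u, mg (T j j') (x, y)) ∂Q ∂Q ∂μ := by
          refine lintegral_congr fun u => ?_
          have hm2 : Measurable fun p : 𝒳 × 𝒳 => w (u, p.1) * w (u, p.2) :=
            (hwm.comp (measurable_const.prodMk measurable_fst)).mul
              (hwm.comp (measurable_const.prodMk measurable_snd))
          have hm3 : Measurable fun p : 𝒳 × 𝒳 => (p.1, mg (T j j') p) :=
            measurable_fst.prodMk (hmg _)
          have h1 := lintegral_map (μ := κ) hm2 ((hev j).prodMk (hev j'))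
          rw [hpair, lintegral_map hm2 hm3, lintegral_prod] at h1
          swap
          · exact (hm2.comp hm3).aemeasurable
          exact h1.symm
      _ ≤ ∫⁻ u, ∫⁻ x, w (u, x) * K (T j j') ∂Q ∂μ := by
          refine lintegral_mono fun u => lintegral_mono fun x => ?_
          rw [lintegral_const_mul]
          swap
          · exact hwm.comp (measurable_const.prodMk ((hmg _).comp measurable_prodMk_left))
          by_cases hx : (u, x) ∈ G
          · gcongr
            refine le_trans (lintegral_mono fun y => ?_) (hK (T j j') (u, x) hx)
            exact Set.indicator_le_self _ _ _
          · simp [hw, hx]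
      _ = (∫⁻ z, w z ∂μ.prod Q) * K (T j j') := by
          rw [← lintegral_mul_const _ hwm, lintegral_prod _ (hwm.mul_const _).aemeasurable]
      _ ≤ K (T j j') := by
          calc _ ≤ 1 * K (T j j') := by gcongr
            _ = _ := one_mul _
  -- Cauchy-Schwarz on the event that some codeword is good
  set E : Set (𝒰 × 𝒞) := {z | ∃ j, (z.1, ev j z.2) ∈ G} with hE
  have hEm : MeasurableSet E := by
    have : E = ⋃ j, (fun z : 𝒰 × 𝒞 => (z.1, ev j z.2)) ⁻¹' G := by ext; simp [hE]
    rw [this]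
    exact .iUnion fun j => (measurable_fst.prodMk ((hev j).comp measurable_snd)) hG
  have hCS : (∫⁻ z, W z ∂μ.prod κ) ^ 2 ≤ (∫⁻ z, W z ^ 2 ∂μ.prod κ) * (μ.prod κ) E := by
    have h := ENNReal.lintegral_mul_le_Lp_mul_Lq (μ.prod κ) Real.HolderConjugate.two_two
      hWm.aemeasurable (g := E.indicator 1) (measurable_one.indicator hEm).aemeasurable
    have h1 : (W * E.indicator 1) = W := by
      ext z
      by_cases hz : z ∈ E
      · simp [hz]
      · have : W z = 0 := by
          simp only [hW]
          refine Finset.sum_eq_zero fun j _ => Set.indicator_of_notMem (fun hj => hz ⟨j, hj⟩) _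
        simp [this]
    have h2 : ∫⁻ a, E.indicator (1 : 𝒰 × 𝒞 → ℝ≥0∞) a ^ (2 : ℝ) ∂μ.prod κ = (μ.prod κ) E := by
      rw [← lintegral_indicator_one hEm]
      refine lintegral_congr fun a => ?_
      by_cases ha : a ∈ E <;> simp [ha]
    rw [h1, h2] at h
    have h3 : ∀ x : ℝ≥0∞, (x ^ (1 / (2 : ℝ))) ^ 2 = x := fun x => by
      rw [← ENNReal.rpow_natCast, ← ENNReal.rpow_mul]; norm_num
    calc (∫⁻ z, W z ∂μ.prod κ) ^ 2 ≤ _ := pow_le_pow_left' h 2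
      _ = _ := by rw [mul_pow, h3, h3]; simp
  have hfin : N ^ 2 * (∫⁻ z, w z ∂μ.prod Q) ^ 2 ≤
      (∑ j, ∑ j', K (T j j')) * (μ.prod κ) E := by
    rw [← mul_pow, ← hEW]
    exact hCS.trans (mul_le_mul_left hEW2 _)
  rw [← hwint, ← mul_div_assoc, ENNReal.le_div_iff_mul_le (by simp [hN0]) (by simp [hNt]),
    mul_comm, mul_comm ((μ.prod κ) E)]
  exact hfin

end OneShot

/-- The average of `K` over the agreement sets of two index tuples: at most
`∏ i, M i / ∏ i ∈ T, M i` tuples agree with a given one on all of `T`. The sets in `Z`, on which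
`K ≤ 1`, account for the summand `1`. -/
theorem sum_agreement_le {I : Type*} [Fintype I] [DecidableEq I] {M : I → ℕ} (hM : ∀ i, 0 < M i)
    (K : Finset I → ℝ≥0∞) (Z : Finset (Finset I)) (hZ : ∀ T ∈ Z, K T ≤ 1) :
    (∑ j : ∀ i, Fin (M i), ∑ j' : ∀ i, Fin (M i), K (Finset.univ.filter fun i => j i = j' i)) /
        (Fintype.card (∀ i, Fin (M i)) : ℝ≥0∞) ^ 2 ≤
      1 + ∑ T ∈ Zᶜ, K T / ∏ i ∈ T, (M i : ℝ≥0∞) := by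
  set N : ℝ≥0∞ := (Fintype.card (∀ i, Fin (M i)) : ℝ≥0∞) with hN
  have hM0 : ∀ i, (M i : ℝ≥0∞) ≠ 0 := fun i => by simpa using (hM i).ne'
  have hMt : ∀ i, (M i : ℝ≥0∞) ≠ ∞ := fun i => ENNReal.natCast_ne_top _
  have hNp : N = ∏ i, (M i : ℝ≥0∞) := by simp [hN]
  have hN0 : N ≠ 0 := by rw [hNp]; exact Finset.prod_ne_zero_iff.2 fun i _ => hM0 i
  have hNt : N ≠ ∞ := ENNReal.natCast_ne_top _
  have hrow : ∀ j : ∀ i, Fin (M i),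
      ∑ j' : ∀ i, Fin (M i), K (Finset.univ.filter fun i => j i = j' i) ≤
        N * (1 + ∑ T ∈ Zᶜ, K T / ∏ i ∈ T, (M i : ℝ≥0∞)) := by
    intro j
    have h1 : ∀ j' : ∀ i, Fin (M i), K (Finset.univ.filter fun i => j i = j' i) ≤
        1 + ∑ T ∈ Zᶜ, if (∀ i ∈ T, j' i = j i) then K T else 0 := by
      intro j'
      set T := Finset.univ.filter fun i => j i = j' i with hT
      by_cases hTZ : T ∈ Z
      · exact (hZ T hTZ).trans le_self_add
      · refine le_trans ?_ le_add_self
        have : K T = if (∀ i ∈ T, j' i = j i) then K T else 0 := by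
          rw [if_pos]
          intro i hi
          simp only [hT, Finset.mem_filter] at hi
          exact hi.2.symm
        rw [this]
        exact Finset.single_le_sum (f := fun T => if (∀ i ∈ T, j' i = j i) then K T else 0)
          (fun _ _ => zero_le) (Finset.mem_compl.2 hTZ)
    refine (Finset.sum_le_sum fun j' _ => h1 j').trans ?_
    rw [Finset.sum_add_distrib, Finset.sum_comm, mul_add, Finset.mul_sum]
    refine add_le_add (by simp [hN]) (Finset.sum_le_sum fun T _ => ?_)
    rw [← Finset.sum_filter, Finset.sum_const, nsmul_eq_mul]
    have hcard : ((Finset.univ.filter fun j' : ∀ i, Fin (M i) => ∀ i ∈ T, j' i = j i).card : ℝ≥0∞)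
        * ∏ i ∈ T, (M i : ℝ≥0∞) = N := by
      have : (Finset.univ.filter fun j' : ∀ i, Fin (M i) => ∀ i ∈ T, j' i = j i) =
          Fintype.piFinset fun i => if i ∈ T then {j i} else Finset.univ := by
        ext j'
        simp only [Finset.mem_filter, Finset.mem_univ, true_and, Fintype.mem_piFinset]
        refine forall_congr' fun i => ?_
        by_cases hi : i ∈ T <;> simp [hi]
      rw [this, Fintype.card_piFinset, hNp]
      rw [← Finset.prod_mul_prod_compl T (fun i => (M i : ℝ≥0∞)), mul_comm]
      congr 1
      rw [Nat.cast_prod, ← Finset.prod_mul_prod_compl T]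
      rw [Finset.prod_eq_one, one_mul]
      · exact Finset.prod_congr rfl fun i hi => by simp [Finset.mem_compl.1 hi]
      · intro i hi; simp [hi]
    have hP0 : ∏ i ∈ T, (M i : ℝ≥0∞) ≠ 0 := Finset.prod_ne_zero_iff.2 fun i _ => hM0 i
    have hPt : ∏ i ∈ T, (M i : ℝ≥0∞) ≠ ∞ := ENNReal.prod_ne_top fun i _ => hMt i
    rw [← hcard, mul_assoc, ENNReal.mul_div_cancel hP0 hPt]
  rw [ENNReal.div_le_iff (by simp [hN0]) (by simp [hNt])]
  calc _ ≤ ∑ j : ∀ i, Fin (M i), N * (1 + ∑ T ∈ Zᶜ, K T / ∏ i ∈ T, (M i : ℝ≥0∞)) :=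
        Finset.sum_le_sum fun j _ => hrow j
    _ = _ := by
      rw [Finset.sum_const, nsmul_eq_mul, Finset.card_univ, ← hN]; ring

/-! ### Laws of large numbers for frequencies and densities -/

section LawOfLargeNumbers

variable {E : Type*} [MeasurableSpace E] {P : Measure E} [IsProbabilityMeasure P]

theorem infinitePi_map_fin (n : ℕ) :
    (Measure.infinitePi fun _ : ℕ => P).map (fun ω (t : Fin n) => ω t) =
      Measure.pi fun _ : Fin n => P := by
  have h1 : iIndepFun (fun (i : ℕ) (ω : ℕ → E) => ω i) (Measure.infinitePi fun _ : ℕ => P) :=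
    iIndepFun_infinitePi (X := fun _ x => x) fun _ => measurable_id
  have h2 := h1.precomp (g := fun t : Fin n => (t : ℕ)) Fin.val_injective
  rw [iIndepFun_iff_map_fun_eq_pi_map fun i => (measurable_pi_apply _).aemeasurable] at h2
  refine h2.trans ?_
  congr 1
  ext1 i
  exact Measure.infinitePi_map_eval _ _

/-- An event that holds eventually along almost every i.i.d. sequence has probability tending to
one for i.i.d. blocks. -/
theorem tendsto_pi_one_of_ae_eventually {s : ∀ n : ℕ, Set (Fin n → E)}
    (hs : ∀ n, MeasurableSet (s n))
    (h : ∀ᵐ ω ∂(Measure.infinitePi fun _ : ℕ => P), ∀ᶠ n in atTop,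
      (fun t : Fin n => ω t) ∈ s n) :
    Tendsto (fun n => (Measure.pi fun _ : Fin n => P) (s n)) atTop (𝓝 1) := by
  have hm : ∀ n : ℕ, Measurable fun (ω : ℕ → E) (t : Fin n) => ω t := fun n => by fun_prop
  have h1 := tendsto_measure_of_ae_tendsto_indicator_of_isFiniteMeasure atTop
    (μ := Measure.infinitePi fun _ : ℕ => P) MeasurableSet.univ
    (fun n => hm n (hs n)) (by
      filter_upwards [h] with ω hω
      filter_upwards [hω] with n hn
      simpa using hn)
  rw [measure_univ] at h1
  refine h1.congr fun n => ?_
  rw [← infinitePi_map_fin n, Measure.map_apply (hm n) (hs n)]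

theorem ae_tendsto_average {ψ : E → ℝ} (hψm : Measurable ψ) (hψ : Integrable ψ P) :
    ∀ᵐ ω ∂(Measure.infinitePi fun _ : ℕ => P),
      Tendsto (fun n : ℕ => (∑ t : Fin n, ψ (ω t)) / n) atTop (𝓝 (∫ z, ψ z ∂P)) := by
  have hmp : ∀ i : ℕ, MeasurePreserving (fun ω : ℕ → E => ω i)
      (Measure.infinitePi fun _ : ℕ => P) P := fun i =>
    measurePreserving_eval_infinitePi (fun _ : ℕ => P) i
  have h1 : iIndepFun (fun (i : ℕ) (ω : ℕ → E) => ψ (ω i)) (Measure.infinitePi fun _ : ℕ => P) :=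
    iIndepFun_infinitePi (X := fun _ => ψ) fun _ => hψm
  have h := strong_law_ae_real (μ := Measure.infinitePi fun _ : ℕ => P)
    (fun i ω => ψ (ω i)) ((hmp 0).integrable_comp_of_integrable hψ)
    (fun i j hij => h1.indepFun hij) (fun i => by
      refine ⟨(hψm.comp (measurable_pi_apply i)).aemeasurable,
        (hψm.comp (measurable_pi_apply 0)).aemeasurable, ?_⟩
      change Measure.map (ψ ∘ fun ω : ℕ → E => ω i) _ = Measure.map (ψ ∘ fun ω : ℕ → E => ω 0) _
      rw [← Measure.map_map hψm (measurable_pi_apply i),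
        ← Measure.map_map hψm (measurable_pi_apply 0), (hmp i).map_eq, (hmp 0).map_eq])
  have hE : ∫ ω : ℕ → E, ψ (ω 0) ∂(Measure.infinitePi fun _ : ℕ => P) = ∫ z, ψ z ∂P := by
    have h := integral_map (μ := Measure.infinitePi fun _ : ℕ => P) (φ := fun ω : ℕ → E => ω 0)
      (measurable_pi_apply 0).aemeasurable (f := ψ) hψm.aestronglyMeasurable
    rw [(hmp 0).map_eq] at h
    exact h.symm
  filter_upwards [h] with ω hω
  rw [hE] at hω
  refine hω.congr fun n => ?_
  rw [Finset.sum_range]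

theorem ae_forall_infinitePi {p : E → Prop} (h : ∀ᵐ z ∂P, p z) :
    ∀ᵐ ω ∂(Measure.infinitePi fun _ : ℕ => P), ∀ t, p (ω t) :=
  ae_all_iff.2 fun t =>
    (measurePreserving_eval_infinitePi (fun _ : ℕ => P) t).quasiMeasurePreserving.ae h

/-- By the law of large numbers, the likelihood `∏ t, g (ω t)` grows at most at the exponential rate
`∫ log g` along almost every sequence. -/
theorem ae_eventually_prod_le {g : E → ℝ≥0∞} {ψ : E → ℝ} (hψm : Measurable ψ)
    (hψ : Integrable ψ P) (hgψ : ∀ᵐ z ∂P, g z ≤ ENNReal.ofReal (Real.exp (ψ z))) {a : ℝ}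
    (ha : ∫ z, ψ z ∂P < a) :
    ∀ᵐ ω ∂(Measure.infinitePi fun _ : ℕ => P), ∀ᶠ n : ℕ in atTop,
      ∏ t : Fin n, g (ω t) ≤ ENNReal.ofReal (Real.exp (n * a)) := by
  filter_upwards [ae_tendsto_average hψm hψ, ae_forall_infinitePi hgψ] with ω h1 h2
  filter_upwards [h1.eventually_lt_const ha, eventually_gt_atTop 0] with n hn hn0
  have hn0' : (0 : ℝ) < n := by exact_mod_cast hn0
  calc ∏ t : Fin n, g (ω t) ≤ ∏ t : Fin n, ENNReal.ofReal (Real.exp (ψ (ω t))) :=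
        Finset.prod_le_prod' fun t _ => h2 t
    _ = ENNReal.ofReal (Real.exp (∑ t : Fin n, ψ (ω t))) := by
        rw [Real.exp_sum, ENNReal.ofReal_prod_of_nonneg fun _ _ => (Real.exp_pos _).le]
    _ ≤ _ := by
        refine ENNReal.ofReal_le_ofReal (Real.exp_le_exp.2 ?_)
        rw [div_lt_iff₀ hn0'] at hn
        linarith

/-- Scheffé's lemma for discrete distributions. -/
theorem tendsto_tsum_abs_sub {κ : Type*} {p : κ → ℝ} (hp : HasSum p 1) (hp0 : ∀ c, 0 ≤ p c)
    {q : ℕ → κ → ℝ} (hq : ∀ᶠ n in atTop, HasSum (q n) 1 ∧ ∀ c, 0 ≤ q n c)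
    (hlim : ∀ c, Tendsto (fun n => q n c) atTop (𝓝 (p c))) :
    Tendsto (fun n => ∑' c, |q n c - p c|) atTop (𝓝 0) := by
  have h1 : Tendsto (fun n => ∑' c, max (p c - q n c) 0) atTop (𝓝 (∑' _ : κ, (0 : ℝ))) := by
    refine tendsto_tsum_of_dominated_convergence hp.summable (fun c => ?_) ?_
    · have := (tendsto_const_nhds (x := p c)).sub (hlim c)
      simpa using this.max (tendsto_const_nhds (x := (0 : ℝ)))
    · filter_upwards [hq] with n hn c
      rw [Real.norm_of_nonneg (le_max_right _ _)]
      exact max_le (by linarith [hn.2 c]) (hp0 c)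
  have h2 := h1.const_mul 2
  rw [tsum_zero, mul_zero] at h2
  refine h2.congr' ?_
  filter_upwards [hq] with n hn
  have hs : Summable fun c => max (p c - q n c) 0 :=
    Summable.of_nonneg_of_le (fun c => le_max_right _ _)
      (fun c => max_le (by linarith [hn.2 c]) (hp0 c)) hp.summable
  have heq : ∀ c, |q n c - p c| = (q n c - p c) + 2 * max (p c - q n c) 0 := by
    intro c
    rcases le_total (q n c) (p c) with h | h
    · rw [abs_of_nonpos (by linarith), max_eq_left (by linarith)]; ring
    · rw [abs_of_nonneg (by linarith), max_eq_right (by linarith)]; ring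
  have hsum := (hn.1.sub hp).add (hs.hasSum.mul_left 2)
  rw [sub_self, zero_add] at hsum
  rw [← hsum.tsum_eq]
  exact tsum_congr fun c => (heq c).symm

theorem hasSum_frequency {κ : Type*} {n : ℕ} (hn : 0 < n) (x : Fin n → κ) :
    HasSum (fun c => (Nat.card {t : Fin n // x t = c} : ℝ) / n) 1 := by
  classical
  have hn' : (n : ℝ) ≠ 0 := by exact_mod_cast hn.ne'
  have h : HasSum (fun c => ∑ t : Fin n, (if c = x t then (1 : ℝ) else 0) / n)
      (∑ _t : Fin n, (1 : ℝ) / n) :=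
    hasSum_sum fun t _ => (hasSum_ite_eq (x t) (1 : ℝ)).div_const _
  have h1 : ∑ _t : Fin n, (1 : ℝ) / n = 1 := by simp [hn']
  rw [h1] at h
  convert h using 2 with c
  rw [← Finset.sum_div, Nat.card_eq_fintype_card, Fintype.card_subtype, Finset.card_filter]
  push_cast
  simp only [eq_comm]

variable {κ : Type*} [Countable κ] [MeasurableSpace κ] [MeasurableSingletonClass κ]

theorem hasSum_real_fiber (P : Measure E) [IsProbabilityMeasure P] {q : E → κ}
    (hq : Measurable q) : HasSum (fun c => P.real {z | q z = c}) 1 := by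
  have h1 : ∑' c, P {z | q z = c} = 1 := by
    rw [← measure_iUnion, ← measure_univ (μ := P)]
    · congr 1; ext z; simp
    · intro c d hcd
      refine Set.disjoint_left.2 fun z hz hz' => hcd ?_
      exact (Set.mem_ofPred.1 hz).symm.trans hz'
    · exact fun c => hq (measurableSet_singleton c)
  have h2 := ENNReal.hasSum_toReal (f := fun c => P {z | q z = c}) (by rw [h1]; simp)
  rw [← ENNReal.tsum_toReal_eq fun c => measure_ne_top _ _, h1] at h2
  exact h2

/-- The quantized type of an i.i.d. sequence converges to the law of a letter in `ℓ¹`. -/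
theorem ae_eventually_typical {q : E → κ} (hq : Measurable q) {ε : ℝ} (hε : 0 < ε) :
    ∀ᵐ ω ∂(Measure.infinitePi fun _ : ℕ => P), ∀ᶠ n : ℕ in atTop,
      ∑' c, |(Nat.card {t : Fin n // q (ω t) = c} : ℝ) / n - P.real {z | q z = c}| ≤ ε := by
  have hcell : ∀ᵐ ω ∂(Measure.infinitePi fun _ : ℕ => P), ∀ c, Tendsto (fun n : ℕ =>
      (Nat.card {t : Fin n // q (ω t) = c} : ℝ) / n) atTop (𝓝 (P.real {z | q z = c})) := by
    refine ae_all_iff.2 fun c => ?_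
    have hmc : MeasurableSet {z | q z = c} := hq (measurableSet_singleton c)
    have h := ae_tendsto_average (P := P) (ψ := {z | q z = c}.indicator 1)
      (measurable_one.indicator hmc) ((integrable_const (1 : ℝ)).indicator hmc)
    rw [integral_indicator_one hmc] at h
    filter_upwards [h] with ω hω
    refine hω.congr fun n => ?_
    classical
    congr 1
    rw [Nat.card_eq_fintype_card, Fintype.card_subtype, Finset.card_filter]
    push_cast
    exact Finset.sum_congr rfl fun t _ => by simp [Set.indicator_apply]
  filter_upwards [hcell] with ω hω
  have := tendsto_tsum_abs_sub (hasSum_real_fiber P hq) (fun c => measureReal_nonneg)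
    (q := fun n c => (Nat.card {t : Fin n // q (ω t) = c} : ℝ) / n)
    (by
      filter_upwards [eventually_gt_atTop 0] with n hn
      exact ⟨hasSum_frequency hn _, fun c => by positivity⟩) hω
  exact this.eventually_le_const hε

end LawOfLargeNumbers

/-! ### Random codebooks -/

theorem pi_map_pair_congr {ι : Type*} [Fintype ι] {γ γ' α β : ι → Type*}
    [∀ i, MeasurableSpace (γ i)] [∀ i, MeasurableSpace (γ' i)]
    [∀ i, MeasurableSpace (α i)] [∀ i, MeasurableSpace (β i)]
    {κ : ∀ i, Measure (γ i)} {κ' : ∀ i, Measure (γ' i)}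
    [∀ i, IsProbabilityMeasure (κ i)] [∀ i, IsProbabilityMeasure (κ' i)]
    {a : ∀ i, γ i → α i} {b : ∀ i, γ i → β i} {a' : ∀ i, γ' i → α i} {b' : ∀ i, γ' i → β i}
    (ha : ∀ i, Measurable (a i)) (hb : ∀ i, Measurable (b i))
    (ha' : ∀ i, Measurable (a' i)) (hb' : ∀ i, Measurable (b' i))
    (h : ∀ i, (κ i).map (fun c => (a i c, b i c)) = (κ' i).map fun c => (a' i c, b' i c)) :
    (Measure.pi κ).map (fun c => (fun i => a i (c i), fun i => b i (c i))) =
      (Measure.pi κ').map fun c => (fun i => a' i (c i), fun i => b' i (c i)) := by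
  have hp : ∀ i, IsProbabilityMeasure ((κ i).map fun c => (a i c, b i c)) := fun i =>
    Measure.isProbabilityMeasure_map ((ha i).prodMk (hb i)).aemeasurable
  have hp' : ∀ i, IsProbabilityMeasure ((κ' i).map fun c => (a' i c, b' i c)) := fun i =>
    Measure.isProbabilityMeasure_map ((ha' i).prodMk (hb' i)).aemeasurable
  have h1 := Measure.pi_map_pi (μ := κ) (f := fun i c => (a i c, b i c))
    fun i => ((ha i).prodMk (hb i)).aemeasurable
  have h2 := Measure.pi_map_pi (μ := κ') (f := fun i c => (a' i c, b' i c))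
    fun i => ((ha' i).prodMk (hb' i)).aemeasurable
  have h3 : (Measure.pi κ).map (fun c i => (a i (c i), b i (c i))) =
      (Measure.pi κ').map fun c i => (a' i (c i), b' i (c i)) := by
    rw [h1, h2]; congr 1; ext1 i; exact h i
  have hu : Measurable fun p : ∀ i, α i × β i => (fun i => (p i).1, fun i => (p i).2) := by
    fun_prop
  have h4 := congrArg
    (Measure.map fun p : ∀ i, α i × β i => (fun i => (p i).1, fun i => (p i).2)) h3
  rwa [Measure.map_map hu (by fun_prop), Measure.map_map hu (by fun_prop)] at h4

section Merge

variable {I : Type*} [DecidableEq I] {Y : I → Type*}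

/-- The vector with coordinates in `T` taken from `p.1` and the others from `p.2`. -/
def mergeOn (T : Finset I) (p : (∀ i, Y i) × (∀ i, Y i)) : ∀ i, Y i :=
  fun i => if i ∈ T then p.1 i else p.2 i

theorem mergeOn_mergeOn (T : Finset I) (x y z : ∀ i, Y i) :
    mergeOn T (mergeOn T (x, y), z) = mergeOn T (x, z) := by
  ext i; by_cases hi : i ∈ T <;> simp [mergeOn, hi]

theorem mergeOn_swap (T : Finset I) (x y : ∀ i, Y i) :
    mergeOn T (mergeOn T (x, y), mergeOn T (y, x)) = x := by
  ext i; by_cases hi : i ∈ T <;> simp [mergeOn, hi]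

variable [∀ i, MeasurableSpace (Y i)]

theorem measurable_mergeOn (T : Finset I) : Measurable (mergeOn (Y := Y) T) := by
  refine measurable_pi_lambda _ fun i => ?_
  by_cases hi : i ∈ T
  · simp only [mergeOn, hi, if_true]; fun_prop
  · simp only [mergeOn, hi, if_false]; fun_prop

variable [Fintype I]

/-- The density of the marginal on `U` and the coordinates in `T` of the law with density `f` with
respect to `μ × ∏ Q i`; it is a function of the full vector that ignores the coordinates outside
`T`. -/
noncomputable def marginalDensity {U : Type*} (Q : ∀ i, Measure (Y i)) (f : U × (∀ i, Y i) → ℝ≥0∞)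
    (T : Finset I) (z : U × (∀ i, Y i)) : ℝ≥0∞ :=
  ∫⁻ y, f (z.1, mergeOn T (z.2, y)) ∂Measure.pi Q

theorem marginalDensity_mergeOn {U : Type*} (Q : ∀ i, Measure (Y i))
    (f : U × (∀ i, Y i) → ℝ≥0∞) (T : Finset I) (u : U)
    (x y : ∀ i, Y i) :
    marginalDensity Q f T (u, mergeOn T (x, y)) = marginalDensity Q f T (u, x) := by
  simp only [marginalDensity, mergeOn_mergeOn]

variable {Q : ∀ i, Measure (Y i)} [∀ i, IsProbabilityMeasure (Q i)]

theorem measurePreserving_mergeOn (T : Finset I) :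
    MeasurePreserving (fun p : (∀ i, Y i) × (∀ i, Y i) => (mergeOn T p, mergeOn T p.swap))
      ((Measure.pi Q).prod (Measure.pi Q)) ((Measure.pi Q).prod (Measure.pi Q)) := by
  have hm : Measurable fun p : (∀ i, Y i) × (∀ i, Y i) => (mergeOn T p, mergeOn T p.swap) :=
    (measurable_mergeOn T).prodMk ((measurable_mergeOn T).comp measurable_swap)
  refine ⟨hm, ?_⟩
  have hite : ∀ i, Measurable fun p : Y i × Y i => if i ∈ T then p.1 else p.2 := fun i => by
    by_cases hi : i ∈ T <;> simp only [hi, if_true, if_false] <;> fun_prop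
  have hite' : ∀ i, Measurable fun p : Y i × Y i => if i ∈ T then p.2 else p.1 := fun i => by
    by_cases hi : i ∈ T <;> simp only [hi, if_true, if_false] <;> fun_prop
  have h := pi_map_pair_congr (κ := fun i => (Q i).prod (Q i)) (κ' := fun i => (Q i).prod (Q i))
    (a := fun i p => if i ∈ T then p.1 else p.2) (b := fun i p => if i ∈ T then p.2 else p.1)
    (a' := fun i p => p.1) (b' := fun i p => p.2) hite hite' (fun _ => measurable_fst)
    (fun _ => measurable_snd) (fun i => by
      by_cases hi : i ∈ T
      · simp [hi]
      · simp only [hi, if_false]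
        rw [show (fun c : Y i × Y i => (c.2, c.1)) = Prod.swap from rfl, Measure.prod_swap]
        exact Measure.map_id.symm)
  have hu : Measurable fun p : ∀ i, Y i × Y i => (fun i => (p i).1, fun i => (p i).2) := by
    fun_prop
  have hu2 : Measurable fun p : ∀ i, Y i × Y i =>
      (fun i => if i ∈ T then (p i).1 else (p i).2, fun i => if i ∈ T then (p i).2 else (p i).1) :=
    (measurable_pi_lambda _ fun i => (hite i).comp (measurable_pi_apply i)).prodMk
      (measurable_pi_lambda _ fun i => (hite' i).comp (measurable_pi_apply i))
  have hz := measurePreserving_zip Q Q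
  rw [← hz.map_eq, Measure.map_map hu2 hz.measurable, Measure.map_map hu hz.measurable] at h
  refine (Eq.trans ?_ h).trans ?_
  · rfl
  · exact Measure.map_id

/-- If `M i` codewords are drawn from `Q i` independently for every `i`, two tuples of codewords are
distributed as a vector and its copy in which the coordinates with different indices are
redrawn. -/
theorem codebook_pair_law {M : I → ℕ} (j j' : ∀ i, Fin (M i)) :
    (Measure.pi fun i => Measure.pi fun _ : Fin (M i) => Q i).map
        (fun c => (fun i => c i (j i), fun i => c i (j' i))) =
      ((Measure.pi Q).prod (Measure.pi Q)).map
        fun p => (p.1, mergeOn (Finset.univ.filter fun i => j i = j' i) p) := by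
  have hite : ∀ i, Measurable fun p : Y i × Y i => if j i = j' i then p.1 else p.2 := fun i => by
    by_cases hi : j i = j' i <;> simp only [hi, if_true, if_false] <;> fun_prop
  have h := pi_map_pair_congr (κ := fun i => Measure.pi fun _ : Fin (M i) => Q i)
    (κ' := fun i => (Q i).prod (Q i)) (a := fun i c => c (j i)) (b := fun i c => c (j' i))
    (a' := fun i p => p.1) (b' := fun i p => if j i = j' i then p.1 else p.2)
    (fun _ => measurable_pi_apply _) (fun _ => measurable_pi_apply _) (fun _ => measurable_fst)
    hite (fun i => by
      by_cases hi : j i = j' i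
      · simp only [hi, if_true]
        have hd : Measurable fun y : Y i => (y, y) := by fun_prop
        have h1 := (measurePreserving_eval (fun _ : Fin (M i) => Q i) (j' i)).map_eq
        have h2 : ((Q i).prod (Q i)).map Prod.fst = Q i := by simp
        calc _ = ((Measure.pi fun _ : Fin (M i) => Q i).map (Function.eval (j' i))).map
              fun y => (y, y) :=
              (Measure.map_map hd (measurable_pi_apply (j' i))).symm
          _ = (((Q i).prod (Q i)).map Prod.fst).map fun y => (y, y) := by rw [h1, h2]
          _ = _ := Measure.map_map hd measurable_fst
      · simp only [hi, if_false]
        have h1 : iIndepFun (fun (m : Fin (M i)) (c : Fin (M i) → Y i) => c m)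
            (Measure.pi fun _ : Fin (M i) => Q i) :=
          iIndepFun_pi (X := fun _ y => y) fun _ => measurable_id.aemeasurable
        have h2 := (indepFun_iff_map_prod_eq_prod_map_map
          (measurable_pi_apply _).aemeasurable (measurable_pi_apply _).aemeasurable).1
          (h1.indepFun hi)
        rw [h2]
        have h3 := (measurePreserving_eval (fun _ : Fin (M i) => Q i) (j i)).map_eq
        have h4 := (measurePreserving_eval (fun _ : Fin (M i) => Q i) (j' i)).map_eq
        refine (congrArg₂ Measure.prod h3 h4).trans ?_
        exact Measure.map_id.symm)
  have hu2 : Measurable fun p : ∀ i, Y i × Y i =>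
      (fun i => (p i).1, fun i => if j i = j' i then (p i).1 else (p i).2) :=
    Measurable.prodMk (by fun_prop)
      (measurable_pi_lambda _ fun i => (hite i).comp (measurable_pi_apply i))
  have hz := measurePreserving_zip Q Q
  rw [← hz.map_eq, Measure.map_map hu2 hz.measurable] at h
  refine h.trans ?_
  congr 1
  ext p i
  · rfl
  · simp [mergeOn]

variable {U : Type*} [MeasurableSpace U] {μ : Measure U}

theorem measurable_marginalDensity {f : U × (∀ i, Y i) → ℝ≥0∞} (hf : Measurable f)
    (T : Finset I) : Measurable (marginalDensity Q f T) := by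
  have hm : Measurable fun w : (U × (∀ i, Y i)) × (∀ i, Y i) =>
      f (w.1.1, mergeOn T (w.1.2, w.2)) := by
    refine hf.comp ((measurable_fst.comp measurable_fst).prodMk ((measurable_mergeOn T).comp ?_))
    fun_prop
  exact hm.lintegral_prod_right'

/-- Redrawing the coordinates outside `T` from the product law leaves the marginal density. -/
theorem map_merge_withDensity [SFinite μ] {f : U × (∀ i, Y i) → ℝ≥0∞} (hf : Measurable f)
    (T : Finset I)
    [SFinite ((μ.prod (Measure.pi Q)).withDensity f)] :
    ((((μ.prod (Measure.pi Q)).withDensity f).prod (Measure.pi Q)).map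
        fun w => (w.1.1, mergeOn T (w.1.2, w.2))) =
      (μ.prod (Measure.pi Q)).withDensity (marginalDensity Q f T) := by
  have hm : Measurable fun w : (U × (∀ i, Y i)) × (∀ i, Y i) =>
      (w.1.1, mergeOn T (w.1.2, w.2)) := by
    refine (measurable_fst.comp measurable_fst).prodMk ((measurable_mergeOn T).comp ?_)
    fun_prop
  refine Measure.ext_of_lintegral _ fun g hg => ?_
  have hgm : Measurable fun w : (U × (∀ i, Y i)) × (∀ i, Y i) =>
      g (w.1.1, mergeOn T (w.1.2, w.2)) := hg.comp hm
  rw [lintegral_map hg hm, lintegral_prod _ hgm.aemeasurable,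
    lintegral_withDensity_eq_lintegral_mul _ hf hgm.lintegral_prod_right',
    lintegral_withDensity_eq_lintegral_mul _ (measurable_marginalDensity hf T) hg]
  rw [lintegral_prod _ (hf.mul hgm.lintegral_prod_right').aemeasurable,
    lintegral_prod _ ((measurable_marginalDensity hf T).mul hg).aemeasurable]
  refine lintegral_congr fun u => ?_
  have hfu : Measurable fun x => f (u, x) := hf.comp measurable_prodMk_left
  have hgu : Measurable fun x => g (u, x) := hg.comp measurable_prodMk_left
  -- `(x, y) ↦ (x_T y_{T^c}, y_T x_{T^c})` is a measure-preserving involution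
  have hH : Measurable fun p : (∀ i, Y i) × (∀ i, Y i) => f (u, p.1) * g (u, mergeOn T p) :=
    (hfu.comp measurable_fst).mul (hgu.comp (measurable_mergeOn T))
  have hH2 : Measurable fun p : (∀ i, Y i) × (∀ i, Y i) => f (u, mergeOn T p) * g (u, p.1) :=
    (hfu.comp (measurable_mergeOn T)).mul (hgu.comp measurable_fst)
  calc ∫⁻ x, f (u, x) * ∫⁻ y, g (u, mergeOn T (x, y)) ∂Measure.pi Q ∂Measure.pi Q
      = ∫⁻ p, f (u, p.1) * g (u, mergeOn T p) ∂(Measure.pi Q).prod (Measure.pi Q) := by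
        rw [lintegral_prod _ hH.aemeasurable]
        refine lintegral_congr fun x => ?_
        refine (lintegral_const_mul _ ?_).symm
        exact hgu.comp ((measurable_mergeOn T).comp measurable_prodMk_left)
    _ = ∫⁻ p, f (u, mergeOn T p) * g (u, p.1) ∂(Measure.pi Q).prod (Measure.pi Q) := by
        rw [← (measurePreserving_mergeOn (Q := Q) T).lintegral_comp hH]
        refine lintegral_congr fun p => ?_
        rw [show mergeOn T (mergeOn T p, mergeOn T p.swap) = p.1 from mergeOn_swap T p.1 p.2]
    _ = _ := by
        rw [lintegral_prod _ hH2.aemeasurable]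
        refine lintegral_congr fun x => ?_
        rw [Pi.mul_apply, marginalDensity]
        refine lintegral_mul_const (g (u, x)) (f := fun y => f (u, mergeOn T (x, y))) ?_
        exact hfu.comp ((measurable_mergeOn T).comp measurable_prodMk_left)

/-- The covering bound for blocks of length `n` and random codebooks with i.i.d. letters, with the
codebook `c` fixed to one at least as good as the average. -/
theorem block_covering [IsProbabilityMeasure μ] {f : U × (∀ i, Y i) → ℝ≥0∞} (hf : Measurable f)
    [IsProbabilityMeasure ((μ.prod (Measure.pi Q)).withDensity f)] {M : I → ℕ}
    (hM : ∀ i, 0 < M i) {n : ℕ} {G : Set (Fin n → U × (∀ i, Y i))} (hG : MeasurableSet G)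
    {K : Finset I → ℝ≥0∞} (hK : ∀ T, ∀ z ∈ G, ∏ t, marginalDensity Q f T (z t) ≤ K T)
    {Z : Finset (Finset I)} (hZ : ∀ T ∈ Z, K T ≤ 1) :
    ∃ c : Fin n → ∀ i, Fin (M i) → Y i,
      (Measure.pi fun _ : Fin n => (μ.prod (Measure.pi Q)).withDensity f) G ^ 2 ≤
        (Measure.pi fun _ : Fin n => μ)
          {u | ∃ j : ∀ i, Fin (M i), (fun t => (u t, fun i => c t i (j i))) ∈ G} *
            (1 + ∑ T ∈ Zᶜ, K T / ∏ i ∈ T, (M i : ℝ≥0∞)) := by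
  have : ∀ i, Nonempty (Fin (M i)) := fun i => ⟨⟨0, hM i⟩⟩
  set Qn : Measure (Fin n → ∀ i, Y i) := Measure.pi fun _ : Fin n => Measure.pi Q with hQn
  set κ : Measure (Fin n → ∀ i, Fin (M i) → Y i) :=
    Measure.pi fun _ : Fin n => Measure.pi fun i => Measure.pi fun _ : Fin (M i) => Q i with hκ
  set ev : (∀ i, Fin (M i)) → (Fin n → ∀ i, Fin (M i) → Y i) → Fin n → ∀ i, Y i :=
    fun j c t i => c t i (j i) with hev
  have hevm : ∀ j, Measurable (ev j) := fun j => by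
    simp only [hev]; fun_prop
  set mg : Finset I → (Fin n → ∀ i, Y i) × (Fin n → ∀ i, Y i) → Fin n → ∀ i, Y i :=
    fun T p t => mergeOn T (p.1 t, p.2 t) with hmg
  have hmgm : ∀ T, Measurable (mg T) := fun T =>
    measurable_pi_lambda _ fun t => (measurable_mergeOn T).comp (by fun_prop)
  have hzip := measurePreserving_zip (fun _ : Fin n => μ) (fun _ : Fin n => Measure.pi Q)
  have hzipQ := measurePreserving_zip (fun _ : Fin n => Measure.pi Q)
    (fun _ : Fin n => Measure.pi Q)
  have hpair : ∀ j j', κ.map (fun c => (ev j c, ev j' c)) = (Qn.prod Qn).map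
      fun p => (p.1, mg (Finset.univ.filter fun i => j i = j' i) p) := by
    intro j j'
    have h := pi_map_pair_congr (ι := Fin n)
      (κ := fun _ => Measure.pi fun i => Measure.pi fun _ : Fin (M i) => Q i)
      (κ' := fun _ => (Measure.pi Q).prod (Measure.pi Q))
      (a := fun _ c i => c i (j i)) (b := fun _ c i => c i (j' i))
      (a' := fun _ p => p.1) (b' := fun _ => mergeOn (Finset.univ.filter fun i => j i = j' i))
      (fun _ => by fun_prop) (fun _ => by fun_prop) (fun _ => measurable_fst)
      (fun _ => measurable_mergeOn _) (fun _ => codebook_pair_law j j')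
    rw [← hzipQ.map_eq, Measure.map_map _ hzipQ.measurable] at h
    · exact h
    · refine Measurable.prodMk (by fun_prop) ?_
      exact measurable_pi_lambda _ fun t => (measurable_mergeOn _).comp (measurable_pi_apply t)
  set zip : (Fin n → U) × (Fin n → ∀ i, Y i) → Fin n → U × (∀ i, Y i) :=
    fun p t => (p.1 t, p.2 t) with hzipdef
  set F : (Fin n → U × (∀ i, Y i)) → ℝ≥0∞ := fun z => ∏ t, f (z t) with hF
  have hFm : Measurable F := Finset.measurable_prod _ fun t _ => hf.comp (measurable_pi_apply t)
  have hpiP : (Measure.pi fun _ : Fin n => (μ.prod (Measure.pi Q)).withDensity f) =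
      (Measure.pi fun _ : Fin n => μ.prod (Measure.pi Q)).withDensity F :=
    pi_withDensity (fun _ => μ.prod (Measure.pi Q)) fun _ => hf
  have hPG : ∫⁻ z in zip ⁻¹' G, (F ∘ zip) z ∂(Measure.pi fun _ : Fin n => μ).prod Qn =
      (Measure.pi fun _ : Fin n => (μ.prod (Measure.pi Q)).withDensity f) G := by
    rw [hpiP, withDensity_apply _ hG]
    exact hzip.setLIntegral_comp_preimage hG hFm
  have hP1 : ∫⁻ z, (F ∘ zip) z ∂(Measure.pi fun _ : Fin n => μ).prod Qn ≤ 1 := by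
    have h := hzip.lintegral_comp hFm
    rw [← setLIntegral_univ F, ← withDensity_apply _ .univ, ← hpiP, measure_univ] at h
    exact h.le
  have hone := one_shot_covering (μ := Measure.pi fun _ : Fin n => μ) (Q := Qn) (κ := κ) hevm hmgm
    hpair (hFm.comp hzip.measurable) hP1 (hzip.measurable hG) (K := K) (by
      intro T z hz
      refine le_trans (le_of_eq ?_) (hK T (zip z) hz)
      simp only [Function.comp, hF, hzipdef, hmg, marginalDensity]
      refine lintegral_pi_prod (fun _ : Fin n => Measure.pi Q)
        (f := fun t y => f (z.1 t, mergeOn T (z.2 t, y))) fun t => ?_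
      exact hf.comp (measurable_const.prodMk ((measurable_mergeOn T).comp measurable_prodMk_left)))
  rw [hPG] at hone
  have hone' := hone.trans (mul_le_mul_right (sum_agreement_le hM K Z hZ) _)
  -- pick a codebook that is at least as good as the average one
  set E : Set ((Fin n → U) × (Fin n → ∀ i, Fin (M i) → Y i)) :=
    {z | ∃ j, (z.1, ev j z.2) ∈ zip ⁻¹' G} with hE
  have hEm : MeasurableSet E := by
    have : E = ⋃ j, (fun z : (Fin n → U) × (Fin n → ∀ i, Fin (M i) → Y i) =>
        (z.1, ev j z.2)) ⁻¹' (zip ⁻¹' G) := by ext; simp [hE]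
    rw [this]
    exact .iUnion fun j => (measurable_fst.prodMk ((hevm j).comp measurable_snd))
      (hzip.measurable hG)
  rw [Measure.prod_apply_symm hEm] at hone'
  obtain ⟨c, hc⟩ := exists_lintegral_le (μ := κ)
    (f := fun c => (Measure.pi fun _ : Fin n => μ) ((fun u => (u, c)) ⁻¹' E))
    (ne_top_of_le_ne_top ENNReal.one_ne_top ((lintegral_mono fun c => prob_le_one).trans
      (by simp)))
  exact ⟨c, hone'.trans (mul_le_mul_left hc _)⟩

end Merge

/-! ### Relative entropy along a mixture -/

section RelativeEntropy

variable {E : Type*} [MeasurableSpace E] {ρ : Measure E} {φ : E → ℝ}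

theorem integrable_exp_mul_self (hφ : Measurable φ)
    (hint : Integrable φ (ρ.withDensity fun z => ENNReal.ofReal (Real.exp (φ z)))) :
    Integrable (fun z => Real.exp (φ z) * φ z) ρ := by
  rw [integrable_withDensity_iff_integrable_smul' (by fun_prop) (by simp)] at hint
  simpa [ENNReal.toReal_ofReal (Real.exp_pos _).le] using hint

theorem integral_exp_mul_self (hφ : Measurable φ) :
    ∫ z, φ z ∂ρ.withDensity (fun z => ENNReal.ofReal (Real.exp (φ z))) =
      ∫ z, Real.exp (φ z) * φ z ∂ρ := by
  rw [integral_withDensity_eq_integral_toReal_smul (by fun_prop) (by simp)]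
  simp [ENNReal.toReal_ofReal (Real.exp_pos _).le]

theorem hasIntegral_exp_one (hφ : Measurable φ)
    [IsProbabilityMeasure (ρ.withDensity fun z => ENNReal.ofReal (Real.exp (φ z)))] :
    Integrable (fun z => Real.exp (φ z)) ρ ∧ ∫ z, Real.exp (φ z) ∂ρ = 1 := by
  have h1 : ∫⁻ z, ENNReal.ofReal (Real.exp (φ z)) ∂ρ = 1 := by
    have := measure_univ (μ := ρ.withDensity fun z => ENNReal.ofReal (Real.exp (φ z)))
    rwa [withDensity_apply _ .univ, setLIntegral_univ] at this
  have hi : Integrable (fun z => Real.exp (φ z)) ρ := by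
    refine ⟨by fun_prop, ?_⟩
    rw [hasFiniteIntegral_iff_ofReal (ae_of_all _ fun z => (Real.exp_pos _).le), h1]
    exact ENNReal.one_lt_top
  refine ⟨hi, ?_⟩
  rw [integral_eq_lintegral_of_nonneg_ae (ae_of_all _ fun z => (Real.exp_pos _).le) hi.1, h1]
  rfl

variable [IsProbabilityMeasure ρ]

/-- Gibbs' inequality with its equality case: a relative entropy is nonnegative, and it vanishes
only for equal laws. -/
theorem integral_log_density_nonneg (hφ : Measurable φ)
    [IsProbabilityMeasure (ρ.withDensity fun z => ENNReal.ofReal (Real.exp (φ z)))]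
    (hint : Integrable φ (ρ.withDensity fun z => ENNReal.ofReal (Real.exp (φ z)))) :
    0 ≤ ∫ z, φ z ∂ρ.withDensity (fun z => ENNReal.ofReal (Real.exp (φ z))) ∧
      (∫ z, φ z ∂ρ.withDensity (fun z => ENNReal.ofReal (Real.exp (φ z))) = 0 → φ =ᵐ[ρ] 0) := by
  have h1 := integrable_exp_mul_self hφ hint
  obtain ⟨h2, h3⟩ := hasIntegral_exp_one (ρ := ρ) hφ
  have hk : ∀ z, InformationTheory.klFun (Real.exp (φ z)) =
      Real.exp (φ z) * φ z + 1 - Real.exp (φ z) := fun z => by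
    rw [InformationTheory.klFun_apply, Real.log_exp]
  have h4 : Integrable (fun z => InformationTheory.klFun (Real.exp (φ z))) ρ := by
    simp_rw [hk]; exact (h1.add (integrable_const 1)).sub h2
  have h5 : ∫ z, InformationTheory.klFun (Real.exp (φ z)) ∂ρ =
      ∫ z, φ z ∂ρ.withDensity (fun z => ENNReal.ofReal (Real.exp (φ z))) := by
    simp_rw [hk]
    have h6 : Integrable (fun z => Real.exp (φ z) * φ z + 1) ρ := h1.add (integrable_const 1)
    rw [integral_sub h6 h2, integral_add h1 (integrable_const 1), h3, integral_exp_mul_self hφ]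
    simp
  have h7 : ∀ z, 0 ≤ InformationTheory.klFun (Real.exp (φ z)) := fun z =>
    InformationTheory.klFun_nonneg (Real.exp_pos _).le
  rw [← h5]
  refine ⟨integral_nonneg h7, fun h => ?_⟩
  rw [integral_eq_zero_iff_of_nonneg h7 h4] at h
  filter_upwards [h] with z hz
  have := (InformationTheory.klFun_eq_zero_iff (Real.exp_pos _).le).1 hz
  simpa using this

theorem mixture_log_le {l a : ℝ} (hl0 : 0 < l) (hl1 : l < 1) :
    (l * Real.exp a + (1 - l)) * Real.log (l * Real.exp a + (1 - l)) ≤ l * (Real.exp a * a) := by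
  have h := Real.convexOn_mul_log.2 (x := Real.exp a) (y := 1) (Real.exp_pos a).le
    (by simp : (1 : ℝ) ∈ Set.Ici 0) hl0.le (sub_nonneg.2 hl1.le) (by ring)
  simpa using h

/-- Convexity of relative entropy in the direction of the reference measure. -/
theorem integrable_mixture (hφ : Measurable φ)
    [IsProbabilityMeasure (ρ.withDensity fun z => ENNReal.ofReal (Real.exp (φ z)))]
    (hint : Integrable φ (ρ.withDensity fun z => ENNReal.ofReal (Real.exp (φ z))))
    {l : ℝ} (hl0 : 0 < l) (hl1 : l < 1) :
    Integrable (fun z => Real.log (l * Real.exp (φ z) + (1 - l)))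
        (ρ.withDensity fun z => ENNReal.ofReal (l * Real.exp (φ z) + (1 - l))) ∧
      ∫ z, Real.log (l * Real.exp (φ z) + (1 - l))
          ∂ρ.withDensity (fun z => ENNReal.ofReal (l * Real.exp (φ z) + (1 - l))) ≤
        l * ∫ z, φ z ∂ρ.withDensity (fun z => ENNReal.ofReal (Real.exp (φ z))) := by
  have h1 := integrable_exp_mul_self hφ hint
  obtain ⟨h2, -⟩ := hasIntegral_exp_one (ρ := ρ) hφ
  have hpos : ∀ z, 0 < l * Real.exp (φ z) + (1 - l) := fun z => by
    have := Real.exp_pos (φ z)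
    have : 0 < 1 - l := by linarith
    positivity
  have hi : Integrable (fun z => (l * Real.exp (φ z) + (1 - l)) *
      Real.log (l * Real.exp (φ z) + (1 - l))) ρ := by
    refine Integrable.mono' ((h1.const_mul l).abs.add
      ((h2.const_mul l).add (integrable_const l)).abs) (by fun_prop) (ae_of_all _ fun z => ?_)
    have hu := mixture_log_le (a := φ z) hl0 hl1
    have hlow : l * Real.exp (φ z) - l ≤ (l * Real.exp (φ z) + (1 - l)) *
        Real.log (l * Real.exp (φ z) + (1 - l)) := by
      have h := Real.one_sub_inv_le_log_of_pos (hpos z)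
      have h' := mul_le_mul_of_nonneg_left h (hpos z).le
      rw [mul_sub, mul_inv_cancel₀ (hpos z).ne'] at h'
      linarith
    simp only [Pi.add_apply, Real.norm_eq_abs]
    refine abs_le.2 ⟨?_, ?_⟩
    · have h3 : 0 ≤ |l * (Real.exp (φ z) * φ z)| := abs_nonneg _
      have h4 : -|l * Real.exp (φ z) + l| ≤ l * Real.exp (φ z) - l := by
        have := Real.exp_pos (φ z)
        rw [abs_of_pos (by positivity)]
        nlinarith
      linarith
    · have h3 := le_abs_self (l * (Real.exp (φ z) * φ z))
      have h4 : 0 ≤ |l * Real.exp (φ z) + l| := abs_nonneg _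
      linarith
  constructor
  · rw [integrable_withDensity_iff_integrable_smul' (by fun_prop) (by simp)]
    simpa [ENNReal.toReal_ofReal (hpos _).le] using hi
  · rw [integral_withDensity_eq_integral_toReal_smul (by fun_prop) (by simp),
      integral_exp_mul_self hφ, ← integral_const_mul]
    simp only [ENNReal.toReal_ofReal (hpos _).le, smul_eq_mul]
    exact integral_mono hi (h1.const_mul l) fun z => mixture_log_le hl0 hl1

end RelativeEntropy

section Typical

variable {E κ : Type*} [MeasurableSpace E] [Countable κ] [MeasurableSpace κ]
  [MeasurableSingletonClass κ]

/-- Types close to the mixture `l P + (1 - l) ρ` are close to `P`. -/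
theorem typical_of_typical_mixture {P ρ P' : Measure E} [IsProbabilityMeasure P]
    [IsProbabilityMeasure ρ] [IsProbabilityMeasure P'] {q : E → κ} (hq : Measurable q) {l ε : ℝ}
    (hl : l ≤ 1)
    (hP' : ∀ s, MeasurableSet s → P'.real s = l * P.real s + (1 - l) * ρ.real s)
    {n : ℕ} (hn : 0 < n) (x : Fin n → κ)
    (hx : ∑' c, |(Nat.card {t : Fin n // x t = c} : ℝ) / n - P'.real {z | q z = c}| ≤ ε) :
    ∑' c, |(Nat.card {t : Fin n // x t = c} : ℝ) / n - P.real {z | q z = c}| ≤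
      ε + 2 * (1 - l) := by
  have hp := hasSum_real_fiber P hq
  have hr := hasSum_real_fiber ρ hq
  have hp' := hasSum_real_fiber P' hq
  have hf := hasSum_frequency hn x
  have hs1 := (hf.summable.sub hp'.summable).abs
  have hb := (hp.add hr).mul_left (1 - l)
  have hpt : ∀ c, |(Nat.card {t : Fin n // x t = c} : ℝ) / n - P.real {z | q z = c}| ≤
      |(Nat.card {t : Fin n // x t = c} : ℝ) / n - P'.real {z | q z = c}| +
        (1 - l) * (P.real {z | q z = c} + ρ.real {z | q z = c}) := by
    intro c
    have h1 := hP' {z | q z = c} (hq (measurableSet_singleton c))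
    have h2 : |P'.real {z | q z = c} - P.real {z | q z = c}| ≤
        (1 - l) * (P.real {z | q z = c} + ρ.real {z | q z = c}) := by
      have ha := measureReal_nonneg (μ := P) (s := {z | q z = c})
      have hb := measureReal_nonneg (μ := ρ) (s := {z | q z = c})
      rw [h1, abs_le]
      constructor <;> nlinarith
    exact (abs_sub_le _ _ _).trans (by linarith)
  calc _ ≤ ∑' c, (|(Nat.card {t : Fin n // x t = c} : ℝ) / n - P'.real {z | q z = c}| +
        (1 - l) * (P.real {z | q z = c} + ρ.real {z | q z = c})) :=
        (hf.summable.sub hp.summable).abs.tsum_le_tsum hpt (hs1.add hb.summable)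
    _ = _ := by rw [hs1.tsum_add hb.summable, hb.tsum_eq]
    _ ≤ _ := by linarith

end Typical

/-! ### Asymptotic mutual covering -/

section

/-- Sizes `M n i ≈ 2 ^ (n C i)` beat second-moment terms of exponent `a T < log 2 · ∑ C i`. -/
theorem tendsto_covering_bound {I : Type*} [Fintype I] [DecidableEq I] {C : I → ℝ}
    {Z : Finset (Finset I)} {a : Finset I → ℝ}
    (ha : ∀ T ∈ Zᶜ, a T < (∑ i ∈ T, C i) * Real.log 2) {M : ℕ → I → ℕ}
    (hM : ∀ (n : ℕ) i, (2 : ℝ) ^ ((n : ℝ) * C i) ≤ 2 * (M n i : ℝ)) (hM0 : ∀ n i, 0 < M n i)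
    {K : ℕ → Finset I → ℝ≥0∞}
    (hK : ∀ n : ℕ, ∀ T ∈ Zᶜ, K n T = ENNReal.ofReal (Real.exp (n * a T))) :
    Tendsto (fun n => 1 + ∑ T ∈ Zᶜ, K n T / ∏ i ∈ T, (M n i : ℝ≥0∞)) atTop (𝓝 1) := by
  have hterm : ∀ T ∈ Zᶜ,
      Tendsto (fun n => K n T / ∏ i ∈ T, (M n i : ℝ≥0∞)) atTop (𝓝 0) := by
    intro T hT
    set b : ℝ := (∑ i ∈ T, C i) * Real.log 2 - a T with hb
    have hb0 : 0 < b := sub_pos.2 (ha T hT)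
    have hlim : Tendsto (fun n : ℕ => ENNReal.ofReal (2 ^ T.card * Real.exp (-(n * b)))) atTop
        (𝓝 0) := by
      have h1 : Tendsto (fun n : ℕ => (n : ℝ) * b) atTop atTop :=
        tendsto_natCast_atTop_atTop.atTop_mul_const hb0
      have h2 := (Real.tendsto_exp_neg_atTop_nhds_zero.comp h1).const_mul ((2 : ℝ) ^ T.card)
      rw [mul_zero] at h2
      simpa using ENNReal.tendsto_ofReal h2
    refine tendsto_of_tendsto_of_tendsto_of_le_of_le tendsto_const_nhds hlim
      (fun _ => zero_le) fun n => ?_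
    have hpos : 0 < ∏ i ∈ T, (M n i : ℝ) :=
      Finset.prod_pos fun i _ => by exact_mod_cast hM0 n i
    have hcast : ∏ i ∈ T, (M n i : ℝ≥0∞) = ENNReal.ofReal (∏ i ∈ T, (M n i : ℝ)) := by
      rw [ENNReal.ofReal_prod_of_nonneg fun _ _ => Nat.cast_nonneg _]
      simp
    rw [hK n T hT, hcast, ← ENNReal.ofReal_div_of_pos hpos]
    refine ENNReal.ofReal_le_ofReal ?_
    rw [div_le_iff₀ hpos]
    have h3 : ∏ i ∈ T, (2 : ℝ) ^ ((n : ℝ) * C i) ≤ 2 ^ T.card * ∏ i ∈ T, (M n i : ℝ) := by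
      rw [← Finset.prod_const, ← Finset.prod_mul_distrib]
      exact Finset.prod_le_prod (fun _ _ => by positivity) fun i _ => hM n i
    have h4 : ∏ i ∈ T, (2 : ℝ) ^ ((n : ℝ) * C i) =
        Real.exp (n * ((∑ i ∈ T, C i) * Real.log 2)) := by
      rw [Finset.sum_mul, Finset.mul_sum, Real.exp_sum]
      refine Finset.prod_congr rfl fun i _ => ?_
      rw [Real.rpow_def_of_pos two_pos]
      congr 1; ring
    have h5 : Real.exp (n * a T) = Real.exp (-(n * b)) *
        Real.exp (n * ((∑ i ∈ T, C i) * Real.log 2)) := by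
      rw [← Real.exp_add]; congr 1; rw [hb]; ring
    rw [h5, mul_comm ((2 : ℝ) ^ T.card), mul_assoc]
    exact mul_le_mul_of_nonneg_left (h4 ▸ h3) (Real.exp_pos _).le
  have := (tendsto_finsetSum _ hterm).const_add (1 : ℝ≥0∞)
  simpa using this

variable {I : Type*} [DecidableEq I] [Fintype I] {Y : I → Type*} [∀ i, MeasurableSpace (Y i)]
  {U : Type*} [MeasurableSpace U] {κ : Type*} [Countable κ] [MeasurableSpace κ]
  [MeasurableSingletonClass κ]

/-- Mutual covering. Here `φ T` is the log-density of the marginal of `P` on `U` and the coordinates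
in `T`, expressed through the law in which the other coordinates are redrawn from `Q`. If every
relative entropy `∫ φ T` is at most `(∑ i ∈ T, C i) log 2`, with equality allowed, then there are
codebooks of rates `C i` such that a source block `u` has, with high probability, codewords whose
joint type with `u`, quantized by `q`, is close to `P`. -/
theorem mutual_covering (μ : Measure U) [IsProbabilityMeasure μ] (Q : ∀ i, Measure (Y i))
    [∀ i, IsProbabilityMeasure (Q i)] (P : Measure (U × ∀ i, Y i)) [IsProbabilityMeasure P]
    {φ : Finset I → U × (∀ i, Y i) → ℝ} (hφ : ∀ T, Measurable (φ T))
    (hPT : ∀ T, (P.prod (Measure.pi Q)).map (fun w => (w.1.1, mergeOn T (w.1.2, w.2))) =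
      (μ.prod (Measure.pi Q)).withDensity fun z => ENNReal.ofReal (Real.exp (φ T z)))
    (hint : ∀ T, Integrable (φ T)
      ((μ.prod (Measure.pi Q)).withDensity fun z => ENNReal.ofReal (Real.exp (φ T z))))
    {C : I → ℝ}
    (hC : ∀ T, ∫ z, φ T z ∂((μ.prod (Measure.pi Q)).withDensity
      fun z => ENNReal.ofReal (Real.exp (φ T z))) ≤ (∑ i ∈ T, C i) * Real.log 2)
    {q : U × (∀ i, Y i) → κ} (hq : Measurable q) {ε δ : ℝ} (hε : 0 < ε) (hδ : 0 < δ) :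
    ∃ n₀ : ℕ, ∀ n ≥ n₀, ∃ M : I → ℕ, (∀ i, 0 < M i) ∧
      (∀ i, (M i : ℝ) ≤ (2 : ℝ) ^ ((n : ℝ) * C i)) ∧ ∃ c : Fin n → ∀ i, Fin (M i) → Y i,
        1 - δ ≤ (Measure.pi fun _ : Fin n => μ).real {u | ∃ j : ∀ i, Fin (M i),
          ∑' k, |(Nat.card {t : Fin n // q (u t, fun i => c t i (j i)) = k} : ℝ) / n -
            P.real {z | q z = k}| ≤ ε} := by
  set R : Measure (U × ∀ i, Y i) := μ.prod (Measure.pi Q) with hR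
  have hmm : ∀ T : Finset I, Measurable fun w : (U × (∀ i, Y i)) × (∀ i, Y i) =>
      (w.1.1, mergeOn T (w.1.2, w.2)) := fun T => by
    refine (measurable_fst.comp measurable_fst).prodMk ((measurable_mergeOn T).comp ?_)
    fun_prop
  have hprob : ∀ T, IsProbabilityMeasure
      (R.withDensity fun z => ENNReal.ofReal (Real.exp (φ T z))) := fun T => by
    rw [← hPT T]; exact Measure.isProbabilityMeasure_map (hmm T).aemeasurable
  set f : U × (∀ i, Y i) → ℝ≥0∞ := fun z => ENNReal.ofReal (Real.exp (φ Finset.univ z)) with hf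
  have hfm : Measurable f := by simp only [hf]; fun_prop
  have hPf : P = R.withDensity f := by
    rw [hf, ← hPT Finset.univ]
    have : (fun w : (U × (∀ i, Y i)) × (∀ i, Y i) =>
        (w.1.1, mergeOn Finset.univ (w.1.2, w.2))) = Prod.fst := by
      ext w <;> simp [mergeOn]
    rw [this]; simp
  have hCnn : ∀ T, 0 ≤ (∑ i ∈ T, C i) * Real.log 2 := fun T =>
    (integral_log_density_nonneg (hφ T) (hint T)).1.trans (hC T)
  have hlog2 : 0 < Real.log 2 := Real.log_pos one_lt_two
  have hCi : ∀ i, 0 ≤ C i := fun i => by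
    have := hCnn {i}
    rw [Finset.sum_singleton] at this
    exact nonneg_of_mul_nonneg_left this hlog2
  -- the marginal densities
  have hmarg : ∀ T, marginalDensity Q f T =ᵐ[R] fun z => ENNReal.ofReal (Real.exp (φ T z)) := by
    intro T
    have h1 := map_merge_withDensity (μ := μ) (Q := Q) hfm T
    rw [← hR, ← hPf, hPT T] at h1
    exact ((withDensity_eq_iff_of_sigmaFinite (by fun_prop)
      (measurable_marginalDensity hfm T).aemeasurable).1 h1).symm
  -- mix in a little of the product law to make the rate conditions strict
  set η : ℝ := min (ε / 4) (1 / 2) with hη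
  have hη0 : 0 < η := by positivity
  have hη1 : η ≤ 1 / 2 := min_le_right _ _
  have hηε : η ≤ ε / 4 := min_le_left _ _
  set l : ℝ := 1 - η with hl
  have hl0 : 0 < l := by linarith
  have hl1 : l < 1 := by linarith
  have hpos : ∀ x : ℝ, 0 < l * Real.exp x + (1 - l) := fun x => by
    have := Real.exp_pos x
    have : 0 < 1 - l := by linarith
    positivity
  set f' : U × (∀ i, Y i) → ℝ≥0∞ :=
    fun z => ENNReal.ofReal l * f z + ENNReal.ofReal (1 - l) with hf'
  have hfm' : Measurable f' := by simp only [hf']; fun_prop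
  have hmarg1 : ∀ T z, marginalDensity Q f' T z =
      ENNReal.ofReal l * marginalDensity Q f T z + ENNReal.ofReal (1 - l) := by
    intro T z
    have hm : Measurable fun y => f (z.1, mergeOn T (z.2, y)) :=
      hfm.comp (measurable_const.prodMk ((measurable_mergeOn T).comp measurable_prodMk_left))
    simp only [marginalDensity, hf']
    rw [lintegral_add_right _ measurable_const, lintegral_const_mul _ hm]
    simp
  have hmarg' : ∀ T, marginalDensity Q f' T =ᵐ[R]
      fun z => ENNReal.ofReal (l * Real.exp (φ T z) + (1 - l)) := by
    intro T
    filter_upwards [hmarg T] with z hz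
    rw [hmarg1, hz, ENNReal.ofReal_add (by positivity) (by linarith), ENNReal.ofReal_mul hl0.le]
  set P' : Measure (U × ∀ i, Y i) := R.withDensity f' with hP'
  have hP'eq : P' = ENNReal.ofReal l • P + ENNReal.ofReal (1 - l) • R := by
    have h1 : f' = (ENNReal.ofReal l • f) + fun _ => ENNReal.ofReal (1 - l) := rfl
    rw [hP', h1, withDensity_add_right _ measurable_const, withDensity_smul _ hfm,
      withDensity_const, hPf]
  have hP'prob : IsProbabilityMeasure P' := by
    constructor
    rw [hP'eq]
    simp only [Measure.add_apply, Measure.smul_apply, measure_univ, smul_eq_mul, mul_one]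
    rw [← ENNReal.ofReal_add hl0.le (by linarith)]
    simp
  have hP'R : P' ≪ R := withDensity_absolutelyContinuous _ _
  have hP'real : ∀ s, MeasurableSet s → P'.real s = l * P.real s + (1 - l) * R.real s := by
    intro s _
    simp only [hP'eq, Measure.real, Measure.add_apply, Measure.smul_apply, smul_eq_mul]
    rw [ENNReal.toReal_add (ENNReal.mul_ne_top ENNReal.ofReal_ne_top (measure_ne_top _ _))
      (ENNReal.mul_ne_top ENNReal.ofReal_ne_top (measure_ne_top _ _)), ENNReal.toReal_mul,
      ENNReal.toReal_mul, ENNReal.toReal_ofReal hl0.le, ENNReal.toReal_ofReal (by linarith)]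
  -- the log-densities of the marginals of `P'`, as functions that see only the coordinates in `T`
  set χ : Finset I → U × (∀ i, Y i) → ℝ :=
    fun T z => Real.log (marginalDensity Q f' T z).toReal with hχ
  have hχm : ∀ T, Measurable (χ T) := fun T =>
    (measurable_marginalDensity hfm' T).ennreal_toReal.log
  have hχR : ∀ T, χ T =ᵐ[R] fun z => Real.log (l * Real.exp (φ T z) + (1 - l)) := by
    intro T
    filter_upwards [hmarg' T] with z hz
    simp only [hχ]
    rw [hz, ENNReal.toReal_ofReal (hpos _).le]
  have hχP' : ∀ T, Integrable (χ T) P' ∧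
      ∫ z, χ T z ∂P' ≤ l * ((∑ i ∈ T, C i) * Real.log 2) := by
    intro T
    obtain ⟨h1, h2⟩ := integrable_mixture (hφ T) (hint T) hl0 hl1
    have h3 := map_merge_withDensity (μ := μ) (Q := Q) hfm' T
    rw [← hR, ← hP'] at h3
    rw [withDensity_congr_ae (hmarg' T)] at h3
    have hac : R.withDensity (fun z => ENNReal.ofReal (l * Real.exp (φ T z) + (1 - l))) ≪ R :=
      withDensity_absolutelyContinuous _ _
    have h4 : χ T =ᵐ[R.withDensity fun z => ENNReal.ofReal (l * Real.exp (φ T z) + (1 - l))]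
        fun z => Real.log (l * Real.exp (φ T z) + (1 - l)) := hac.ae_le (hχR T)
    have h1' := h1.congr h4.symm
    have h2' : ∫ z, χ T z ∂(R.withDensity
        fun z => ENNReal.ofReal (l * Real.exp (φ T z) + (1 - l))) ≤
          l * ((∑ i ∈ T, C i) * Real.log 2) := by
      rw [integral_congr_ae h4]
      exact h2.trans (mul_le_mul_of_nonneg_left (hC T) hl0.le)
    have h5 : (χ T ∘ fun w : (U × (∀ i, Y i)) × (∀ i, Y i) =>
        (w.1.1, mergeOn T (w.1.2, w.2))) = χ T ∘ Prod.fst := by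
      ext w
      simp only [Function.comp, hχ, marginalDensity_mergeOn]
    rw [← h3] at h1' h2'
    rw [integral_map (hmm T).aemeasurable (hχm T).aestronglyMeasurable] at h2'
    rw [integrable_map_measure (hχm T).aestronglyMeasurable (hmm T).aemeasurable, h5,
      ← integrable_map_measure (hχm T).aestronglyMeasurable measurable_fst.aemeasurable] at h1'
    have h7 : (P'.prod (Measure.pi Q)).map Prod.fst = P' := by simp
    rw [h7] at h1'
    refine ⟨h1', le_trans (le_of_eq ?_) h2'⟩
    have h8 := integral_map (μ := P'.prod (Measure.pi Q)) measurable_fst.aemeasurable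
      (f := χ T) (hχm T).aestronglyMeasurable
    rw [h7] at h8
    rw [h8]
    exact (congrArg (fun F => ∫ w, F w ∂P'.prod (Measure.pi Q)) h5).symm
  have hχle : ∀ T, ∀ᵐ z ∂P', marginalDensity Q f' T z ≤ ENNReal.ofReal (Real.exp (χ T z)) := by
    intro T
    filter_upwards [hP'R.ae_le (hmarg' T), hP'R.ae_le (hχR T)] with z h1 h2
    rw [h1, h2, Real.exp_log (hpos _)]
  -- the agreement sets that cost no rate: there the marginal is the product law and `K = 1`; for
  -- the others the exponent `a T` lies strictly between the rate of the mixture and that of the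
  -- code
  classical
  set Z : Finset (Finset I) := Finset.univ.filter fun T => ∑ i ∈ T, C i = 0 with hZ
  have hZone : ∀ T ∈ Z, ∀ᵐ z ∂P', marginalDensity Q f' T z = 1 := by
    intro T hT
    have hT0 : ∑ i ∈ T, C i = 0 := (Finset.mem_filter.1 hT).2
    obtain ⟨h1, h2⟩ := integral_log_density_nonneg (hφ T) (hint T)
    have h3 := hC T
    rw [hT0, zero_mul] at h3
    filter_upwards [hP'R.ae_le (hmarg' T), hP'R.ae_le (h2 (le_antisymm h3 h1))] with z h4 h5
    rw [h4, h5]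
    simp
  set a : Finset I → ℝ := fun T => (1 + l) / 2 * ((∑ i ∈ T, C i) * Real.log 2) with ha
  have hCpos : ∀ T ∈ Zᶜ, 0 < (∑ i ∈ T, C i) * Real.log 2 := by
    intro T hT
    refine lt_of_le_of_ne (hCnn T) fun h => ?_
    have : ∑ i ∈ T, C i = 0 := by
      rcases mul_eq_zero.1 h.symm with h | h
      · exact h
      · exact absurd h hlog2.ne'
    exact Finset.mem_compl.1 hT (Finset.mem_filter.2 ⟨Finset.mem_univ _, this⟩)
  set K : ℕ → Finset I → ℝ≥0∞ := fun n T =>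
    if T ∈ Z then 1 else ENNReal.ofReal (Real.exp (n * a T)) with hK
  set M : ℕ → I → ℕ := fun n i => ⌊(2 : ℝ) ^ ((n : ℝ) * C i)⌋₊ with hM
  have hMone : ∀ (n : ℕ) i, 1 ≤ (2 : ℝ) ^ ((n : ℝ) * C i) := fun n i =>
    Real.one_le_rpow one_le_two (mul_nonneg (Nat.cast_nonneg _) (hCi i))
  have hMpos : ∀ n i, 0 < M n i := fun n i => Nat.floor_pos.2 (hMone n i)
  have hMle : ∀ (n : ℕ) i, (M n i : ℝ) ≤ (2 : ℝ) ^ ((n : ℝ) * C i) := fun n i =>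
    Nat.floor_le (by positivity)
  have hMge : ∀ (n : ℕ) i, (2 : ℝ) ^ ((n : ℝ) * C i) ≤ 2 * M n i := fun n i => by
    have h1 := (Nat.lt_floor_add_one ((2 : ℝ) ^ ((n : ℝ) * C i))).le
    have h2 : (1 : ℝ) ≤ M n i := by exact_mod_cast hMpos n i
    change _ ≤ (M n i : ℝ) + 1 at h1
    linarith
  -- the good blocks
  set G : ∀ n : ℕ, Set (Fin n → U × ∀ i, Y i) := fun n =>
    {z | ∑' k, |(Nat.card {t : Fin n // q (z t) = k} : ℝ) / n - P'.real {z | q z = k}| ≤ ε / 2} ∩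
      ⋂ T, {z | ∏ t, marginalDensity Q f' T (z t) ≤ K n T} with hG
  have hGm : ∀ n, MeasurableSet (G n) := by
    intro n
    refine MeasurableSet.inter ?_ (.iInter fun T => measurableSet_le ?_ measurable_const)
    · have hm : Measurable fun (z : Fin n → U × ∀ i, Y i) (t : Fin n) => q (z t) := by fun_prop
      exact hm (Set.to_countable {x : Fin n → κ | ∑' k, |(Nat.card {t : Fin n // x t = k} : ℝ) / n -
        P'.real {z | q z = k}| ≤ ε / 2}).measurableSet
    · exact Finset.measurable_prod _ fun t _ =>
        (measurable_marginalDensity hfm' T).comp (measurable_pi_apply t)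
  have hG1 : Tendsto (fun n => (Measure.pi fun _ : Fin n => P') (G n)) atTop (𝓝 1) := by
    refine tendsto_pi_one_of_ae_eventually hGm ?_
    have hall : ∀ T, ∀ᵐ ω ∂(Measure.infinitePi fun _ : ℕ => P'), ∀ᶠ n : ℕ in atTop,
        ∏ t : Fin n, marginalDensity Q f' T (ω t) ≤ K n T := by
      intro T
      by_cases hT : T ∈ Z
      · filter_upwards [ae_forall_infinitePi (hZone T hT)] with ω hω
        refine Eventually.of_forall fun n => ?_
        simp [hω, hK, hT]
      · have hlt : ∫ z, χ T z ∂P' < a T := by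
          have := hCpos T (Finset.mem_compl.2 hT)
          refine (hχP' T).2.trans_lt ?_
          simp only [ha]
          nlinarith
        simpa only [hK, if_neg hT] using
          ae_eventually_prod_le (hχm T) (hχP' T).1 (hχle T) hlt
    filter_upwards [ae_eventually_typical hq (half_pos hε), ae_all_iff.2 hall] with ω h1 h2
    filter_upwards [h1, eventually_all.2 h2] with n h3 h4
    exact ⟨h3, Set.mem_iInter.2 h4⟩
  have hB := tendsto_covering_bound (Z := Z) (a := a) (C := C) (M := M) (K := K)
    (fun T hT => by
      have := hCpos T hT
      simp only [ha]; nlinarith) hMge hMpos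
    (fun n T hT => by simp only [hK, if_neg (Finset.mem_compl.1 hT)])
  have hratio := ENNReal.Tendsto.div (ENNReal.Tendsto.pow (n := 2) hG1) (by simp) hB (by simp)
  rw [one_pow, div_one] at hratio
  have hlt : ENNReal.ofReal (1 - δ) < 1 := by
    rw [← ENNReal.ofReal_one, ENNReal.ofReal_lt_ofReal_iff one_pos]; linarith
  obtain ⟨n₀, hn₀⟩ := eventually_atTop.1
    ((hratio.eventually_const_lt hlt).and (eventually_gt_atTop 0))
  refine ⟨n₀, fun n hn => ⟨M n, hMpos n, hMle n, ?_⟩⟩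
  obtain ⟨hn1, hn2⟩ := hn₀ n hn
  obtain ⟨c, hc⟩ := block_covering (μ := μ) hfm' (hMpos n) (hGm n) (K := K n) (Z := Z)
    (fun T z hz => Set.mem_iInter.1 hz.2 T) (fun T hT => by simp [hK, hT])
  refine ⟨c, ?_⟩
  have h1 := hn1.le.trans (ENNReal.div_le_of_le_mul hc)
  have h2 := (ENNReal.ofReal_le_iff_le_toReal (measure_ne_top _ _)).1 h1
  refine h2.trans (measureReal_mono ?_)
  rintro u ⟨j, hj⟩
  refine ⟨j, ?_⟩
  have := typical_of_typical_mixture hq hl1.le hP'real hn2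
    (fun t => q (u t, fun i => c t i (j i))) hj.1
  refine this.trans ?_
  linarith

end

/-! ### Complex Gaussian laws -/

section Sqrt
open scoped MatrixOrder Matrix.Norms.L2Operator

variable {ι : Type} [Fintype ι] [DecidableEq ι]

theorem sqrt_mul_sqrt {R : Matrix ι ι ℂ} (hR : R.PosSemidef) : CFC.sqrt R * CFC.sqrt R = R :=
  CFC.sqrt_mul_sqrt_self R hR.nonneg

theorem sqrt_conjTranspose (R : Matrix ι ι ℂ) : (CFC.sqrt R)ᴴ = CFC.sqrt R :=
  (CFC.sqrt_nonneg R).isSelfAdjoint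

theorem exists_CN_eq_map {R : Matrix ι ι ℂ} (hR : R.PosSemidef) :
    ∃ S : Matrix ι ι ℂ, S * S = R ∧ Sᴴ = S ∧ CN R = (stdCN ι).map fun w => S *ᵥ w :=
  ⟨CFC.sqrt R, sqrt_mul_sqrt hR, sqrt_conjTranspose R, rfl⟩

end Sqrt

section CharFun

variable {ι : Type} [Fintype ι]

theorem integral_exp_stdComplexNormal (a : ℂ) :
    ∫ z, Complex.exp ((star a * z).re * Complex.I) ∂stdComplexNormal =
      Complex.exp (-(Complex.normSq a) / 4) := by
  rw [stdComplexNormal, integral_map measurable_complex_mk.aemeasurable]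
  · have h : ∀ p : ℝ × ℝ, Complex.exp ((star a * (⟨p.1, p.2⟩ : ℂ)).re * Complex.I) =
        Complex.exp (a.re * p.1 * Complex.I) * Complex.exp (a.im * p.2 * Complex.I) := by
      intro p
      rw [← Complex.exp_add]
      congr 1
      simp [Complex.mul_re]
      ring
    simp_rw [h]
    rw [integral_prod_mul (fun x : ℝ => Complex.exp (a.re * x * Complex.I))
      (fun x : ℝ => Complex.exp (a.im * x * Complex.I))]
    have h1 : ∀ t : ℝ, ∫ x, Complex.exp (t * x * Complex.I) ∂gaussianReal 0 (1 / 2) =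
        Complex.exp (-(t ^ 2) / 4) := by
      intro t
      rw [← charFun_apply_real, charFun_gaussianReal]
      congr 1
      push_cast
      ring
    rw [h1, h1, ← Complex.exp_add, Complex.normSq_apply]
    congr 1
    push_cast
    ring
  · refine Measurable.aestronglyMeasurable ?_
    fun_prop

theorem integral_exp_stdCN (a : ι → ℂ) :
    ∫ w, Complex.exp ((star a ⬝ᵥ w).re * Complex.I) ∂stdCN ι =
      Complex.exp (-((star a ⬝ᵥ a).re : ℂ) / 4) := by
  have h : ∀ w : ι → ℂ, Complex.exp ((star a ⬝ᵥ w).re * Complex.I) =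
      ∏ k, Complex.exp ((star (a k) * w k).re * Complex.I) := by
    intro w
    rw [← Complex.exp_sum, ← Finset.sum_mul]
    simp [dotProduct]
  simp_rw [h, stdCN]
  rw [integral_fintype_prod_eq_prod (μ := fun _ => stdComplexNormal)
    (f := fun k z => Complex.exp ((star (a k) * z).re * Complex.I))]
  simp_rw [integral_exp_stdComplexNormal]
  rw [← Complex.exp_sum, ← Finset.sum_div]
  congr 2
  simp only [dotProduct, Complex.re_sum, Complex.ofReal_sum, ← Finset.sum_neg_distrib]
  refine Finset.sum_congr rfl fun k _ => ?_
  simp [Complex.normSq_apply]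

/-- A real functional on `ℂ^ι` is `z ↦ Re (a† z)`, so the characteristic function of `B w` at it is
`exp (-(a† B B† a) / 4)`. -/
theorem charFunDual_map_mulVec (L : StrongDual ℝ (ι → ℂ)) :
    ∃ a : ι → ℂ, ∀ (κ : Type) [Fintype κ] (B : Matrix ι κ ℂ),
      charFunDual ((stdCN κ).map fun w => B *ᵥ w) L =
        Complex.exp (-((star a ⬝ᵥ (B * Bᴴ) *ᵥ a).re : ℂ) / 4) := by
  classical
  refine ⟨fun k => ⟨L (Pi.single k 1), L (Pi.single k Complex.I)⟩, fun κ _ B => ?_⟩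
  set a : ι → ℂ := fun k => ⟨L (Pi.single k 1), L (Pi.single k Complex.I)⟩ with ha
  have hL : ∀ z : ι → ℂ, L z = (star a ⬝ᵥ z).re := by
    intro z
    have hz : z = ∑ k, ((z k).re • (Pi.single k (1 : ℂ) : ι → ℂ) +
        (z k).im • (Pi.single k Complex.I : ι → ℂ)) := by
      ext l
      simp [Finset.sum_apply, Pi.single_apply, Finset.sum_add_distrib]
    conv_lhs => rw [hz]
    simp only [map_sum, map_add, map_smul, smul_eq_mul, dotProduct, Complex.re_sum]
    refine Finset.sum_congr rfl fun k _ => ?_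
    simp [ha, Complex.mul_re]
    ring
  rw [charFunDual_apply, integral_map (measurable_mulVec B).aemeasurable]
  · have h : ∀ w : κ → ℂ, L (B *ᵥ w) = (star (Bᴴ *ᵥ a) ⬝ᵥ w).re := by
      intro w
      rw [hL, Matrix.star_mulVec, Matrix.conjTranspose_conjTranspose, Matrix.dotProduct_mulVec]
    simp_rw [h]
    rw [integral_exp_stdCN]
    rw [Matrix.star_mulVec, Matrix.conjTranspose_conjTranspose, ← Matrix.dotProduct_mulVec,
      Matrix.mulVec_mulVec]
  · refine Measurable.aestronglyMeasurable ?_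
    fun_prop

variable {κ : Type} [Fintype κ]

/-- The law of `B w` with `w ~ CN(0, I)` depends only on `B B†`, by comparing characteristic
functions. In particular `CN R` may be computed from any factor of `R`, not only its square root. -/
theorem map_mulVec_stdCN [DecidableEq ι] (B : Matrix ι κ ℂ) :
    (stdCN κ).map (fun w => B *ᵥ w) = CN (B * Bᴴ) := by
  obtain ⟨S, h1, h2, h3⟩ := exists_CN_eq_map (Matrix.posSemidef_self_mul_conjTranspose B)
  rw [h3]
  have : IsProbabilityMeasure ((stdCN κ).map fun w => B *ᵥ w) :=
    Measure.isProbabilityMeasure_map (measurable_mulVec _).aemeasurable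
  have : IsProbabilityMeasure ((stdCN ι).map fun w => S *ᵥ w) :=
    Measure.isProbabilityMeasure_map (measurable_mulVec _).aemeasurable
  refine Measure.ext_of_charFunDual (funext fun L => ?_)
  obtain ⟨a, ha⟩ := charFunDual_map_mulVec L
  rw [ha, ha, h2, h1]

theorem stdCN_eq_CN [DecidableEq ι] : stdCN ι = CN (1 : Matrix ι ι ℂ) := by
  have h := map_mulVec_stdCN (1 : Matrix ι ι ℂ)
  simpa using h

theorem map_mulVec_CN [DecidableEq ι] [DecidableEq κ] {R : Matrix κ κ ℂ} (hR : R.PosSemidef)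
    (B : Matrix ι κ ℂ) : (CN R).map (fun z => B *ᵥ z) = CN (B * R * Bᴴ) := by
  obtain ⟨S, h1, h2, h3⟩ := exists_CN_eq_map hR
  rw [h3, Measure.map_map (measurable_mulVec _) (measurable_mulVec _)]
  have : ((fun z => B *ᵥ z) ∘ fun w => S *ᵥ w) = fun w => (B * S) *ᵥ w := by
    ext w; simp
  rw [this, map_mulVec_stdCN, Matrix.conjTranspose_mul, h2, ← h1]
  simp only [Matrix.mul_assoc]

theorem map_add_CN_prod {κ' : Type} [Fintype κ'] [DecidableEq ι] [DecidableEq κ] [DecidableEq κ']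
    {R : Matrix κ κ ℂ} {R' : Matrix κ' κ' ℂ} (hR : R.PosSemidef) (hR' : R'.PosSemidef)
    (B : Matrix ι κ ℂ) (B' : Matrix ι κ' ℂ) :
    ((CN R).prod (CN R')).map (fun p => B *ᵥ p.1 + B' *ᵥ p.2) =
      CN (B * R * Bᴴ + B' * R' * B'ᴴ) := by
  obtain ⟨S, h1, h2, h3⟩ := exists_CN_eq_map hR
  obtain ⟨S', h1', h2', h3'⟩ := exists_CN_eq_map hR'
  have hsum := measurePreserving_sumPiEquivProdPi_symm (ι := κ) (ι' := κ') (X := fun _ => ℂ)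
    fun _ => stdComplexNormal
  have hm : Measurable fun p : (κ → ℂ) × (κ' → ℂ) => B *ᵥ p.1 + B' *ᵥ p.2 :=
    ((measurable_mulVec B).comp measurable_fst).add ((measurable_mulVec B').comp measurable_snd)
  have hm2 : Measurable (Prod.map (fun w : κ → ℂ => S *ᵥ w) (fun w : κ' → ℂ => S' *ᵥ w)) :=
    (measurable_mulVec S).prodMap (measurable_mulVec S')
  rw [h3, h3', Measure.map_prod_map _ _ (measurable_mulVec S) (measurable_mulVec S'),
    Measure.map_map hm hm2]
  have hcomp : ((fun p : (κ → ℂ) × (κ' → ℂ) => B *ᵥ p.1 + B' *ᵥ p.2) ∘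
      Prod.map (fun w : κ → ℂ => S *ᵥ w) (fun w : κ' → ℂ => S' *ᵥ w)) =
      (fun w => (Matrix.fromCols (B * S) (B' * S')) *ᵥ w) ∘
        (MeasurableEquiv.sumPiEquivProdPi fun _ : κ ⊕ κ' => ℂ).symm := by
    ext p
    simp only [Function.comp, Prod.map]
    rw [Matrix.fromCols_mulVec]
    simp only [Matrix.mulVec_mulVec]
    rfl
  rw [hcomp, ← Measure.map_map (measurable_mulVec _) (MeasurableEquiv.measurable _)]
  change (Measure.map _ (Measure.prod (Measure.pi fun _ => stdComplexNormal)
    (Measure.pi fun _ => stdComplexNormal))).map _ = _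
  rw [hsum.map_eq]
  change (stdCN (κ ⊕ κ')).map _ = _
  rw [map_mulVec_stdCN, Matrix.conjTranspose_fromCols_eq_fromRows_conjTranspose,
    Matrix.fromCols_mul_fromRows, Matrix.conjTranspose_mul, Matrix.conjTranspose_mul, h2, h2',
    ← h1, ← h1']
  simp only [Matrix.mul_assoc]

end CharFun

section SecondMoment

theorem memLp_stdComplexNormal : MemLp (fun z : ℂ => z) 2 stdComplexNormal := by
  have h1 : MemLp (fun p : ℝ × ℝ => p.1) 2
      ((gaussianReal 0 (1 / 2)).prod (gaussianReal 0 (1 / 2))) :=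
    (memLp_id_gaussianReal 2).comp_fst _
  have h2 : MemLp (fun p : ℝ × ℝ => p.2) 2
      ((gaussianReal 0 (1 / 2)).prod (gaussianReal 0 (1 / 2))) :=
    (memLp_id_gaussianReal 2).comp_snd _
  rw [stdComplexNormal, memLp_map_measure_iff (by fun_prop) measurable_complex_mk.aemeasurable]
  have h3 := h1.ofReal (K := ℂ) |>.add ((h2.ofReal (K := ℂ)).const_mul Complex.I)
  refine h3.congr_norm (by
    exact measurable_complex_mk.aestronglyMeasurable) (ae_of_all _ fun p => ?_)
  congr 1
  apply Complex.ext <;> simp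

theorem integral_stdComplexNormal : ∫ z, z ∂stdComplexNormal = 0 := by
  have hi := memLp_stdComplexNormal.integrable one_le_two
  have hint : ∀ f : ℂ → ℝ, Measurable f → ∫ z, f z ∂stdComplexNormal =
      ∫ p : ℝ × ℝ, f ⟨p.1, p.2⟩ ∂(gaussianReal 0 (1 / 2)).prod (gaussianReal 0 (1 / 2)) :=
    fun f hf => integral_map measurable_complex_mk.aemeasurable hf.aestronglyMeasurable
  have h1 : ∫ z : ℂ, z.re ∂stdComplexNormal = 0 := by
    rw [hint _ Complex.measurable_re]
    simp only
    rw [integral_fun_fst (fun x : ℝ => x)]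
    simp
  have h2 : ∫ z : ℂ, z.im ∂stdComplexNormal = 0 := by
    rw [hint _ Complex.measurable_im]
    simp only
    rw [integral_fun_snd (fun x : ℝ => x)]
    simp
  have h3 := integral_re hi
  have h4 := integral_im hi
  simp only [RCLike.re_to_complex, RCLike.im_to_complex] at h3 h4
  exact Complex.ext (by rw [← h3, h1]; rfl) (by rw [← h4, h2]; rfl)

theorem integral_star_mul_self_stdComplexNormal :
    ∫ z, star z * z ∂stdComplexNormal = 1 := by
  have hsq : ∫ x, x ^ 2 ∂gaussianReal 0 (1 / 2) = 1 / 2 := by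
    have h := variance_id_gaussianReal (μ := 0) (v := 1 / 2)
    rw [variance_eq_integral aemeasurable_id] at h
    simpa using h
  have hsi : Integrable (fun x : ℝ => x ^ 2) (gaussianReal 0 (1 / 2)) :=
    (memLp_id_gaussianReal 2).integrable_sq
  have h0 : ∀ z : ℂ, star z * z = ((z.re ^ 2 + z.im ^ 2 : ℝ) : ℂ) := by
    intro z
    rw [show star z * z = (Complex.normSq z : ℂ) from Complex.normSq_eq_conj_mul_self.symm,
      Complex.normSq_apply]
    push_cast; ring
  simp_rw [h0]
  rw [integral_complex_ofReal, stdComplexNormal,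
    integral_map measurable_complex_mk.aemeasurable (by
      exact Measurable.aestronglyMeasurable (by fun_prop))]
  simp only
  rw [integral_add (hsi.comp_fst _) (hsi.comp_snd _), integral_fun_fst (fun x : ℝ => x ^ 2),
    integral_fun_snd (fun x : ℝ => x ^ 2), hsq]
  norm_num

variable {ι : Type} [Fintype ι] [DecidableEq ι]

theorem integral_star_mul_stdCN (k l : ι) :
    Integrable (fun w : ι → ℂ => star (w k) * w l) (stdCN ι) ∧
      ∫ w, star (w k) * w l ∂stdCN ι = if k = l then 1 else 0 := by
  have hmp : ∀ k : ι, MeasurePreserving (Function.eval k) (stdCN ι) stdComplexNormal := fun k =>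
    measurePreserving_eval (fun _ : ι => stdComplexNormal) k
  have hL : ∀ k : ι, MemLp (fun w : ι → ℂ => w k) 2 (stdCN ι) := fun k =>
    memLp_stdComplexNormal.comp_measurePreserving (hmp k)
  have hS : ∀ k : ι, MemLp (fun w : ι → ℂ => star (w k)) 2 (stdCN ι) := fun k => (hL k).star
  refine ⟨(hS k).integrable_mul (hL l), ?_⟩
  have hE : ∀ (k : ι) (f : ℂ → ℂ), Measurable f → ∫ w, f (w k) ∂stdCN ι =
      ∫ z, f z ∂stdComplexNormal := by
    intro k f hf
    rw [← (hmp k).map_eq, integral_map (measurable_pi_apply k).aemeasurable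
      hf.aestronglyMeasurable]
  split_ifs with h
  · subst h
    rw [hE k (fun z => star z * z) (by fun_prop), integral_star_mul_self_stdComplexNormal]
  · have hind : iIndepFun (fun (k : ι) (w : ι → ℂ) => w k) (stdCN ι) :=
      iIndepFun_pi (X := fun _ y => y) fun _ => measurable_id.aemeasurable
    have h2 := (hind.indepFun h).comp (φ := star) (ψ := id) (by fun_prop) measurable_id
    have h3 := h2.integral_mul_eq_mul_integral (hS k).1 (hL l).1
    have h4 : ∫ w : ι → ℂ, w l ∂stdCN ι = 0 := by
      rw [hE l (fun z => z) measurable_id, integral_stdComplexNormal]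
    calc _ = _ := h3
      _ = _ * ∫ w : ι → ℂ, w l ∂stdCN ι := rfl
      _ = 0 := by rw [h4, mul_zero]

theorem integral_sum_star_mul_stdCN (V : ι → ι → ℂ) :
    Integrable (fun w : ι → ℂ => ∑ k, ∑ l, V k l * (star (w k) * w l)) (stdCN ι) ∧
      ∫ w : ι → ℂ, ∑ k, ∑ l, V k l * (star (w k) * w l) ∂stdCN ι = ∑ k, V k k := by
  have h1 : ∀ k l, Integrable (fun w : ι → ℂ => V k l * (star (w k) * w l)) (stdCN ι) :=
    fun k l => (integral_star_mul_stdCN k l).1.const_mul _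
  have h2 : ∀ k, Integrable (fun w : ι → ℂ => ∑ l, V k l * (star (w k) * w l)) (stdCN ι) :=
    fun k => integrable_finsetSum _ fun l _ => h1 k l
  refine ⟨integrable_finsetSum _ fun k _ => h2 k, ?_⟩
  rw [integral_finsetSum _ fun k _ => h2 k]
  refine Finset.sum_congr rfl fun k _ => ?_
  rw [integral_finsetSum _ fun l _ => h1 k l]
  simp only [integral_const_mul, (integral_star_mul_stdCN k _).2]
  simp

theorem integral_quadratic_CN {R : Matrix ι ι ℂ} (hR : R.PosSemidef)
    (N : Matrix ι ι ℂ) :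
    Integrable (fun z : ι → ℂ => (star z ⬝ᵥ N *ᵥ z).re) (CN R) ∧
      ∫ z, (star z ⬝ᵥ N *ᵥ z).re ∂CN R = (N * R).trace.re := by
  obtain ⟨S, h1, h2, h3⟩ := exists_CN_eq_map hR
  have hm : Measurable fun z : ι → ℂ => (star z ⬝ᵥ N *ᵥ z).re := by
    have := measurable_mulVec N
    simp only [dotProduct]
    fun_prop
  have hq : ∀ w : ι → ℂ, star (S *ᵥ w) ⬝ᵥ N *ᵥ (S *ᵥ w) =
      ∑ k, ∑ l, (S * N * S) k l * (star (w k) * w l) := by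
    intro w
    rw [Matrix.star_mulVec, h2, ← Matrix.dotProduct_mulVec, Matrix.mulVec_mulVec,
      Matrix.mulVec_mulVec]
    simp only [dotProduct, Matrix.mulVec, Finset.mul_sum, Pi.star_apply]
    exact Finset.sum_congr rfl fun k _ => Finset.sum_congr rfl fun l _ => by ring
  obtain ⟨hi, hsum⟩ := integral_sum_star_mul_stdCN (S * N * S)
  rw [h3, integrable_map_measure hm.aestronglyMeasurable (measurable_mulVec S).aemeasurable,
    integral_map (measurable_mulVec S).aemeasurable hm.aestronglyMeasurable]
  have hcomp : ((fun z : ι → ℂ => (star z ⬝ᵥ N *ᵥ z).re) ∘ fun w => S *ᵥ w) =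
      fun w => (∑ k, ∑ l, (S * N * S) k l * (star (w k) * w l)).re := by
    ext w; simp only [Function.comp, hq]
  refine ⟨by rw [hcomp]; exact hi.re, ?_⟩
  simp_rw [hq]
  have hre := integral_re hi
  simp only [RCLike.re_to_complex] at hre
  refine hre.trans (congrArg Complex.re ?_)
  rw [hsum]
  change (S * N * S).trace = _
  rw [Matrix.mul_assoc, Matrix.trace_mul_comm, Matrix.mul_assoc, h1]

end SecondMoment

/-! ### Gaussian densities and entropies -/

section Density

variable {ι : Type} [Fintype ι]

theorem stdComplexNormal_eq_withDensity : stdComplexNormal =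
    volume.withDensity fun z => ENNReal.ofReal (Real.pi⁻¹ * Real.exp (-Complex.normSq z)) := by
  have hg : gaussianReal 0 (1 / 2) = volume.withDensity (gaussianPDF 0 (1 / 2)) :=
    gaussianReal_of_var_ne_zero _ (by norm_num)
  have hpdf : ∀ x : ℝ, gaussianPDF 0 (1 / 2) x =
      ENNReal.ofReal ((Real.sqrt Real.pi)⁻¹ * Real.exp (-x ^ 2)) := by
    intro x
    rw [gaussianPDF, gaussianPDFReal]
    congr 2
    · push_cast; congr 2; ring
    · push_cast; congr 1; ring
  have hmp := Complex.volume_preserving_equiv_real_prod.symm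
  have hs : Real.sqrt Real.pi * Real.sqrt Real.pi = Real.pi := Real.mul_self_sqrt Real.pi_pos.le
  set g : ℂ → ℝ≥0∞ :=
    fun z => ENNReal.ofReal (Real.pi⁻¹ * Real.exp (-Complex.normSq z)) with hgdef
  have hgm : Measurable g := by
    simp only [hgdef, Complex.normSq_apply]; fun_prop
  have hprod : ((gaussianReal 0 (1 / 2)).prod (gaussianReal 0 (1 / 2))) =
      (volume : Measure (ℝ × ℝ)).withDensity fun p => g ⟨p.1, p.2⟩ := by
    rw [hg, prod_withDensity (measurable_gaussianPDF _ _) (measurable_gaussianPDF _ _)]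
    refine withDensity_congr_ae (ae_of_all _ fun p => ?_)
    simp only [hpdf, hgdef]
    rw [← ENNReal.ofReal_mul (by positivity)]
    congr 1
    rw [Complex.normSq_apply, mul_mul_mul_comm, ← mul_inv, hs, ← Real.exp_add]
    congr 2
    ring
  ext s hs'
  rw [stdComplexNormal, hprod, Measure.map_apply measurable_complex_mk hs',
    withDensity_apply _ (measurable_complex_mk hs'), withDensity_apply _ hs']
  exact hmp.setLIntegral_comp_preimage hs' hgm

theorem stdCN_eq_withDensity : stdCN ι = volume.withDensity fun w : ι → ℂ =>
    ENNReal.ofReal (Real.exp (-(Fintype.card ι * Real.log Real.pi) - (star w ⬝ᵥ w).re)) := by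
  have hm : Measurable fun z : ℂ =>
      ENNReal.ofReal (Real.pi⁻¹ * Real.exp (-Complex.normSq z)) := by
    simp only [Complex.normSq_apply]; fun_prop
  have hprob : IsProbabilityMeasure ((volume : Measure ℂ).withDensity
      fun z => ENNReal.ofReal (Real.pi⁻¹ * Real.exp (-Complex.normSq z))) := by
    rw [← stdComplexNormal_eq_withDensity]; infer_instance
  rw [stdCN, stdComplexNormal_eq_withDensity, pi_withDensity (fun _ : ι => (volume : Measure ℂ))
    fun _ => hm]
  refine withDensity_congr_ae (ae_of_all _ fun w => ?_)
  simp only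
  rw [← ENNReal.ofReal_prod_of_nonneg fun _ _ => by positivity]
  congr 1
  rw [Finset.prod_mul_distrib, Finset.prod_const, Finset.card_univ, sub_eq_add_neg, Real.exp_add,
    ← Real.exp_sum]
  congr 1
  · rw [← mul_neg, ← Real.log_inv, mul_comm, Real.exp_mul, Real.exp_log (by positivity),
      Real.rpow_natCast]
  · simp only [dotProduct, Complex.re_sum, ← Finset.sum_neg_distrib]
    congr 1
    refine Finset.sum_congr rfl fun k _ => ?_
    simp [Complex.normSq_apply]

theorem hasDiffEntropy_withDensity_exp {φ : (ι → ℂ) → ℝ} (hφ : Measurable φ)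
    {μ : Measure (ι → ℂ)} (hμ : μ = volume.withDensity fun z => ENNReal.ofReal (Real.exp (φ z)))
    (hint : Integrable φ μ) :
    HasDiffEntropy μ ∧ diffEntropy μ = -(∫ z, φ z ∂μ) / Real.log 2 := by
  have hd : density μ =ᵐ[volume] fun z => Real.exp (φ z) := by
    have h1 := Measure.rnDeriv_withDensity (volume : Measure (ι → ℂ))
      (f := fun z => ENNReal.ofReal (Real.exp (φ z))) (by fun_prop)
    rw [← hμ] at h1
    filter_upwards [h1] with z hz
    rw [density, hz, ENNReal.toReal_ofReal (Real.exp_pos _).le]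
  have hd2 : (fun z => density μ z * Real.logb 2 (density μ z)) =ᵐ[volume]
      fun z => Real.exp (φ z) * φ z / Real.log 2 := by
    filter_upwards [hd] with z hz
    rw [hz, Real.logb, Real.log_exp, mul_div_assoc]
  have hi : Integrable (fun z => Real.exp (φ z) * φ z) := by
    rw [hμ, integrable_withDensity_iff_integrable_smul' (by fun_prop) (by simp)] at hint
    simpa [ENNReal.toReal_ofReal (Real.exp_pos _).le] using hint
  refine ⟨⟨hμ ▸ withDensity_absolutelyContinuous _ _, ?_⟩, ?_⟩
  · exact (hi.div_const _).congr hd2.symm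
  · rw [diffEntropy, integral_congr_ae hd2, integral_div, neg_div]
    congr 2
    rw [hμ, integral_withDensity_eq_integral_toReal_smul (by fun_prop) (by simp)]
    simp [ENNReal.toReal_ofReal (Real.exp_pos _).le]

theorem map_add_withDensity (v : ι → ℂ) {f : (ι → ℂ) → ℝ≥0∞} (hf : Measurable f) :
    ((volume : Measure (ι → ℂ)).withDensity f).map (fun z => v + z) =
      volume.withDensity fun z => f (z - v) := by
  ext s hs
  rw [Measure.map_apply (by fun_prop) hs, withDensity_apply _ (by measurability),
    withDensity_apply _ hs, ← (measurePreserving_add_left volume v).setLIntegral_comp_preimage hs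
      (f := fun z => f (z - v)) (by fun_prop)]
  simp

variable [DecidableEq ι]

/-- The logarithm `-d log π - log det R - z† R⁻¹ z` of the density of `CN(0, R)` on `ℂ^d`. -/
noncomputable def logDensityCN (R : Matrix ι ι ℂ) (z : ι → ℂ) : ℝ :=
  -(Fintype.card ι * Real.log Real.pi) - Real.log R.det.re - (star z ⬝ᵥ R⁻¹ *ᵥ z).re

theorem measurable_logDensityCN (R : Matrix ι ι ℂ) : Measurable (logDensityCN R) := by
  have := measurable_mulVec R⁻¹
  unfold logDensityCN
  simp only [dotProduct]
  fun_prop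

/-- The Jacobian of a complex matrix as a real linear map is `|det S|²`. -/
theorem map_volume_mulVec {S : Matrix ι ι ℂ} (hS : S.det ≠ 0) :
    (volume : Measure (ι → ℂ)).map (fun w => S *ᵥ w) =
      ENNReal.ofReal (Complex.normSq S.det)⁻¹ • volume := by
  have hdet : LinearMap.det ((Matrix.toLin' S).restrictScalars ℝ) = Complex.normSq S.det := by
    rw [LinearMap.det_restrictScalars, LinearMap.det_toLin']
    exact Algebra.norm_complex_apply _
  have h := Measure.map_linearMap_addHaar_eq_smul_addHaar (volume : Measure (ι → ℂ))
    (f := (Matrix.toLin' S).restrictScalars ℝ) (by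
      rw [hdet]; simpa using hS)
  rw [hdet, abs_of_nonneg (inv_nonneg.2 (Complex.normSq_nonneg _))] at h
  exact h

theorem CN_eq_withDensity {R : Matrix ι ι ℂ} (hR : R.PosDef) :
    CN R = volume.withDensity fun z => ENNReal.ofReal (Real.exp (logDensityCN R z)) := by
  obtain ⟨S, h1, h2, h3⟩ := exists_CN_eq_map hR.posSemidef
  have hdet : S.det * S.det = R.det := by rw [← Matrix.det_mul, h1]
  have hR0 : R.det ≠ 0 := hR.det_pos.ne'
  have hS0 : S.det ≠ 0 := fun h => hR0 (by rw [← hdet, h, zero_mul])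
  have hSre : star S.det = S.det := by rw [← Matrix.det_conjTranspose, h2]
  have hRre : R.det.re = Complex.normSq S.det := by
    have : R.det = (Complex.normSq S.det : ℂ) := by
      rw [← hdet, Complex.normSq_eq_conj_mul_self]
      exact congrArg (· * S.det) hSre.symm
    rw [this, Complex.ofReal_re]
  have hpos : 0 < R.det.re := by rw [hRre]; exact Complex.normSq_pos.2 hS0
  have hquad : ∀ w : ι → ℂ, star (S *ᵥ w) ⬝ᵥ R⁻¹ *ᵥ (S *ᵥ w) = star w ⬝ᵥ w := by
    intro w
    have hSu : IsUnit S.det := isUnit_iff_ne_zero.2 hS0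
    have : S * R⁻¹ * S = 1 := by
      rw [← h1, Matrix.mul_inv_rev, ← Matrix.mul_assoc, Matrix.mul_nonsing_inv _ hSu,
        Matrix.one_mul, Matrix.nonsing_inv_mul _ hSu]
    rw [Matrix.star_mulVec, h2, ← Matrix.dotProduct_mulVec, Matrix.mulVec_mulVec,
      Matrix.mulVec_mulVec, this, Matrix.one_mulVec]
  set h : (ι → ℂ) → ℝ≥0∞ := fun z => ENNReal.ofReal
    (Real.exp (-(Fintype.card ι * Real.log Real.pi) - (star z ⬝ᵥ R⁻¹ *ᵥ z).re)) with hh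
  have hhm : Measurable h := by
    have := measurable_mulVec R⁻¹
    simp only [hh, dotProduct]
    fun_prop
  have hfac : (fun z => ENNReal.ofReal (Real.exp (logDensityCN R z))) =
      ENNReal.ofReal (Complex.normSq S.det)⁻¹ • h := by
    ext z
    simp only [hh, Pi.smul_apply, smul_eq_mul, logDensityCN]
    rw [← ENNReal.ofReal_mul (inv_nonneg.2 (Complex.normSq_nonneg _)), ← hRre,
      ← Real.exp_log (inv_pos.2 hpos), ← Real.exp_add, Real.log_inv]
    congr 2
    ring
  ext s hs
  rw [h3, Measure.map_apply (measurable_mulVec S) hs, stdCN_eq_withDensity,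
    withDensity_apply _ (measurable_mulVec S hs), hfac, withDensity_smul _ hhm, Measure.smul_apply,
    withDensity_apply _ hs]
  have h4 := setLIntegral_map (μ := (volume : Measure (ι → ℂ))) hs hhm (measurable_mulVec S)
  rw [map_volume_mulVec hS0, Measure.restrict_smul, lintegral_smul_measure] at h4
  rw [h4]
  simp only [hh, hquad]

theorem integral_logDensityCN {R R' : Matrix ι ι ℂ} (hR' : R'.PosSemidef) :
    Integrable (logDensityCN R) (CN R') ∧ ∫ z, logDensityCN R z ∂CN R' =
      -(Fintype.card ι * Real.log Real.pi) - Real.log R.det.re - (R⁻¹ * R').trace.re := by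
  obtain ⟨h1, h2⟩ := integral_quadratic_CN hR' R⁻¹
  refine ⟨(integrable_const _).sub h1, ?_⟩
  simp only [logDensityCN]
  rw [integral_sub (integrable_const _) h1, h2]
  simp

theorem integral_logDensityCN_self {R : Matrix ι ι ℂ} (hR : R.PosDef) :
    ∫ z, logDensityCN R z ∂CN R =
      -(Fintype.card ι * Real.log Real.pi) - Real.log R.det.re - Fintype.card ι := by
  rw [(integral_logDensityCN hR.posSemidef).2, Matrix.nonsing_inv_mul _
    (isUnit_iff_ne_zero.2 hR.det_pos.ne'), Matrix.trace_one]
  simp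

/-- The entropy of a Gaussian vector on `ℂ^d` with mean `v` and covariance `R` is
`d log₂ (π e) + log₂ det R`. -/
theorem diffEntropy_CN {R : Matrix ι ι ℂ} (hR : R.PosDef) (v : ι → ℂ) :
    HasDiffEntropy ((CN R).map fun z => v + z) ∧
      diffEntropy ((CN R).map fun z => v + z) =
        Fintype.card ι * (Real.log Real.pi + 1) / Real.log 2 + logDet R := by
  have hm := measurable_logDensityCN R
  have hm' : Measurable fun z => logDensityCN R (z - v) := hm.comp (by fun_prop)
  have h1 : (CN R).map (fun z => v + z) =
      volume.withDensity fun z => ENNReal.ofReal (Real.exp (logDensityCN R (z - v))) := by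
    rw [CN_eq_withDensity hR, map_add_withDensity v (by fun_prop)]
  have hv : Measurable fun z : ι → ℂ => v + z := by fun_prop
  obtain ⟨hi, -⟩ := integral_logDensityCN (R := R) hR.posSemidef
  have h2 : Integrable (fun z => logDensityCN R (z - v)) ((CN R).map fun z => v + z) := by
    rw [integrable_map_measure hm'.aestronglyMeasurable hv.aemeasurable]
    simpa [Function.comp_def] using hi
  have h3 : ∫ z, logDensityCN R (z - v) ∂(CN R).map (fun z => v + z) =
      ∫ z, logDensityCN R z ∂CN R := by
    rw [integral_map hv.aemeasurable hm'.aestronglyMeasurable]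
    simp
  obtain ⟨h4, h5⟩ := hasDiffEntropy_withDensity_exp hm' h1 h2
  refine ⟨h4, ?_⟩
  rw [h5, h3, integral_logDensityCN_self hR, logDet, Real.logb]
  ring

end Density

/-! ### Block structure of covariance matrices -/

section Matrices

/-- `∑ j, B j† M j B j` is positive definite if the kernels of the `B j` meet only in zero. -/
theorem posDef_sum_conj {ι J : Type*} [Fintype ι] [Fintype J]
    {B M : J → Matrix ι ι ℂ} (hM : ∀ j, (M j).PosDef)
    (hB : ∀ x, (∀ j, B j *ᵥ x = 0) → x = 0) : (∑ j, (B j)ᴴ * M j * B j).PosDef := by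
  refine Matrix.PosDef.of_dotProduct_mulVec_pos ?_ fun x hx => ?_
  · have : ∀ j, ((B j)ᴴ * M j * B j).IsHermitian := fun j =>
      Matrix.isHermitian_conjTranspose_mul_mul _ (hM j).1
    simp only [Matrix.IsHermitian, Matrix.conjTranspose_sum]
    exact Finset.sum_congr rfl fun j _ => this j
  · have hq : ∀ j, star x ⬝ᵥ ((B j)ᴴ * M j * B j) *ᵥ x =
        star (B j *ᵥ x) ⬝ᵥ (M j *ᵥ (B j *ᵥ x)) := fun j => by
      rw [Matrix.star_mulVec, ← Matrix.dotProduct_mulVec, Matrix.mulVec_mulVec,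
        Matrix.mulVec_mulVec, Matrix.mul_assoc]
    rw [Matrix.sum_mulVec, dotProduct_sum]
    simp_rw [hq]
    obtain ⟨j, hj⟩ : ∃ j, B j *ᵥ x ≠ 0 := by
      by_contra! h
      exact hx (hB x h)
    refine Finset.sum_pos' (fun j _ => (hM j).posSemidef.dotProduct_mulVec_nonneg _)
      ⟨j, Finset.mem_univ _, (hM j).dotProduct_mulVec_pos hj⟩

theorem det_of_blocks {α : Type*} [Fintype α] [LinearOrder α] {m : α → Type*} [∀ i, Fintype (m i)]
    [∀ i, DecidableEq (m i)] (M : Matrix (Σ i, m i) (Σ i, m i) ℂ)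
    (hM : ∀ p q, p.1 ≠ q.1 → M p q = 0) :
    M.det = ∏ i, (M.submatrix (Sigma.mk i) (Sigma.mk i)).det := by
  have hb : M.BlockTriangular Sigma.fst := fun p q h => hM p q h.ne'
  rw [hb.det_fintype]
  refine Finset.prod_congr rfl fun i _ => ?_
  rw [← Matrix.det_submatrix_equiv_self (Equiv.sigmaSubtype i).symm]
  rfl

variable {NB NM : ℕ} {nB : Fin NB → ℕ} {r : Fin NM → ℕ}

/-- `S` with all blocks between different base stations set to zero. -/
def blockDiagPart (S : Matrix (Ant nB) (Ant nB) ℂ) : Matrix (Ant nB) (Ant nB) ℂ :=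
  fun p q => if p.1 = q.1 then S p q else 0

/-- The orthogonal projection onto the antennas of the base stations in `T`. -/
def antProj (nB : Fin NB → ℕ) (T : Finset (Fin NB)) : Matrix (Ant nB) (Ant nB) ℂ :=
  Matrix.diagonal fun p => if p.1 ∈ T then 1 else 0

/-- The embedding of the antennas of the base stations in `S` into all antennas. -/
def antEmb (nB : Fin NB → ℕ) (S : Finset (Fin NB)) (q : AntOf nB S) : Ant nB := ⟨q.1.1, q.2⟩

theorem antEmb_injective (S : Finset (Fin NB)) : Function.Injective (antEmb nB S) := by
  rintro ⟨⟨i, hi⟩, a⟩ ⟨⟨j, hj⟩, b⟩ h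
  simp only [antEmb, Sigma.mk.injEq] at h
  obtain ⟨rfl, h⟩ := h
  rw [eq_of_heq h]

theorem antProj_conjTranspose (T : Finset (Fin NB)) : (antProj nB T)ᴴ = antProj nB T := by
  rw [antProj, Matrix.diagonal_conjTranspose]
  congr 1
  ext p
  by_cases h : p.1 ∈ T <;> simp [h]

theorem antProj_mulVec (T : Finset (Fin NB)) (x : Ant nB → ℂ) (p : Ant nB) :
    (antProj nB T *ᵥ x) p = if p.1 ∈ T then x p else 0 := by
  rw [antProj, Matrix.mulVec_diagonal]
  simp

theorem antProj_mul_mul (T : Finset (Fin NB)) (M : Matrix (Ant nB) (Ant nB) ℂ) (p q : Ant nB) :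
    (antProj nB T * M * antProj nB T) p q = if p.1 ∈ T ∧ q.1 ∈ T then M p q else 0 := by
  rw [antProj, Matrix.mul_diagonal, Matrix.diagonal_mul]
  by_cases h1 : p.1 ∈ T <;> by_cases h2 : q.1 ∈ T <;> simp [h1, h2]

theorem blockDiagPart_eq_sum (S : Matrix (Ant nB) (Ant nB) ℂ) :
    blockDiagPart S = ∑ i, (antProj nB {i})ᴴ * S * antProj nB {i} := by
  ext p q
  rw [Matrix.sum_apply]
  simp only [antProj_conjTranspose, antProj_mul_mul, Finset.mem_singleton, blockDiagPart]
  split_ifs with h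
  · simp [h]
  · refine (Finset.sum_eq_zero fun i _ => if_neg ?_).symm
    rintro ⟨h1, h2⟩
    exact h (h1.trans h2.symm)

theorem posDef_blockDiagPart {S : Matrix (Ant nB) (Ant nB) ℂ} (hS : S.PosDef) :
    (blockDiagPart S).PosDef := by
  rw [blockDiagPart_eq_sum]
  refine posDef_sum_conj (fun _ => hS) fun x hx => funext fun p => ?_
  have := congrFun (hx p.1) p
  rwa [antProj_mulVec, if_pos (by simp)] at this

theorem blockDiagPart_eq_blockDiagonal' (S : Matrix (Ant nB) (Ant nB) ℂ) :
    blockDiagPart S = Matrix.blockDiagonal' fun i => block S i i := by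
  ext ⟨i, a⟩ ⟨j, b⟩
  by_cases h : i = j
  · subst h
    rw [Matrix.blockDiagonal'_apply_eq]
    simp [blockDiagPart, block]
  · rw [Matrix.blockDiagonal'_apply_ne _ _ _ h]
    simp [blockDiagPart, h]

theorem posDef_block {S : Matrix (Ant nB) (Ant nB) ℂ} (hS : S.PosDef) (i : Fin NB) :
    (block S i i).PosDef :=
  hS.submatrix (e := fun a => (⟨i, a⟩ : Ant nB)) fun a b h => by simpa using h

theorem inv_blockDiagPart {S : Matrix (Ant nB) (Ant nB) ℂ} (hS : S.PosDef) :
    (blockDiagPart S)⁻¹ = Matrix.blockDiagonal' fun i => (block S i i)⁻¹ := by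
  refine Matrix.inv_eq_right_inv ?_
  rw [blockDiagPart_eq_blockDiagonal', ← Matrix.blockDiagonal'_mul, ← Matrix.blockDiagonal'_one]
  congr 1
  ext1 i
  exact Matrix.mul_nonsing_inv _ (isUnit_iff_ne_zero.2 (posDef_block hS i).det_pos.ne')

/-- The block covariance that has the entries of `Ω` within the base stations of `T`, those of `K`
within the others, and no correlation between the two groups. -/
def mergedCov (Ω K : Matrix (Ant nB) (Ant nB) ℂ) (T : Finset (Fin NB)) :
    Matrix (Ant nB) (Ant nB) ℂ :=
  antProj nB T * Ω * (antProj nB T)ᴴ + antProj nB Tᶜ * K * (antProj nB Tᶜ)ᴴ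

theorem mergedCov_apply (Ω K : Matrix (Ant nB) (Ant nB) ℂ) (T : Finset (Fin NB)) (p q : Ant nB) :
    mergedCov Ω K T p q =
      if p.1 ∈ T ∧ q.1 ∈ T then Ω p q else if p.1 ∉ T ∧ q.1 ∉ T then K p q else 0 := by
  rw [mergedCov, antProj_conjTranspose, antProj_conjTranspose, Matrix.add_apply, antProj_mul_mul,
    antProj_mul_mul]
  by_cases h1 : p.1 ∈ T <;> by_cases h2 : q.1 ∈ T <;> simp [h1, h2]

theorem posDef_mergedCov {Ω K : Matrix (Ant nB) (Ant nB) ℂ} (hΩ : Ω.PosDef) (hK : K.PosDef)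
    (T : Finset (Fin NB)) : (mergedCov Ω K T).PosDef := by
  have h := posDef_sum_conj (J := Bool) (M := fun b => if b then Ω else K)
    (B := fun b => if b then antProj nB T else antProj nB Tᶜ)
    (fun b => by cases b <;> simp [hΩ, hK]) (fun x hx => funext fun p => by
      by_cases hp : p.1 ∈ T
      · have := congrFun (hx true) p
        simpa [antProj_mulVec, hp] using this
      · have := congrFun (hx false) p
        simpa [antProj_mulVec, hp] using this)
  simpa [mergedCov, antProj_conjTranspose] using h

/-- Only the diagonal blocks of `V` enter the trace of a block-diagonal matrix times `V`,
and here they are those of `S`. -/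
theorem trace_inv_blockDiagPart_mul {S V : Matrix (Ant nB) (Ant nB) ℂ} (hS : S.PosDef)
    (h : ∀ p q : Ant nB, p.1 = q.1 → V p q = S p q) :
    ((blockDiagPart S)⁻¹ * V).trace = Fintype.card (Ant nB) := by
  have hK := posDef_blockDiagPart hS
  have h1 : ((blockDiagPart S)⁻¹ * V).trace = ((blockDiagPart S)⁻¹ * blockDiagPart S).trace := by
    simp only [Matrix.trace, Matrix.diag, Matrix.mul_apply]
    refine Finset.sum_congr rfl fun p _ => Finset.sum_congr rfl fun q _ => ?_
    by_cases hpq : q.1 = p.1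
    · rw [h q p hpq, blockDiagPart, if_pos hpq]
    · rw [inv_blockDiagPart hS, show p = ⟨p.1, p.2⟩ from rfl, show q = ⟨q.1, q.2⟩ from rfl,
        Matrix.blockDiagonal'_apply_ne _ _ _ (Ne.symm hpq)]
      simp
  rw [h1, Matrix.nonsing_inv_mul _ (isUnit_iff_ne_zero.2 hK.det_pos.ne'), Matrix.trace_one]

theorem log_re_mul {z w : ℂ} (hz : 0 < z) (hw : 0 < w) :
    Real.log (z * w).re = Real.log z.re + Real.log w.re := by
  rw [Complex.pos_iff] at hz hw
  rw [Complex.mul_re, ← hz.2, zero_mul, sub_zero, Real.log_mul hz.1.ne' hw.1.ne']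

theorem log_re_prod {ι : Type*} (s : Finset ι) {f : ι → ℂ} (hf : ∀ i ∈ s, 0 < f i) :
    0 < ∏ i ∈ s, f i ∧ Real.log (∏ i ∈ s, f i).re = ∑ i ∈ s, Real.log (f i).re := by
  classical
  induction s using Finset.induction_on with
  | empty => simp
  | insert i s hi ih =>
    obtain ⟨h1, h2⟩ := ih fun j hj => hf j (Finset.mem_insert_of_mem hj)
    have h3 := hf i (Finset.mem_insert_self _ _)
    rw [Finset.prod_insert hi, Finset.sum_insert hi, log_re_mul h3 h1, h2]
    exact ⟨mul_pos h3 h1, rfl⟩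

/-- The two descriptions of the antennas of `S`: as a sigma type over `S`, and as a subtype. -/
def antOfEquiv (nB : Fin NB → ℕ) (S : Finset (Fin NB)) :
    AntOf nB S ≃ {p : Ant nB // p.1 ∈ S} where
  toFun q := ⟨antEmb nB S q, q.1.2⟩
  invFun p := ⟨⟨p.1.1, p.2⟩, p.1.2⟩
  left_inv _ := rfl
  right_inv _ := rfl

/-- Outside `T` the matrices `blockDiagPart S` and `mergedCov Ω (blockDiagPart S) T` agree, so the
difference of their log-determinants involves the blocks in `T` only. -/
theorem log_det_blockDiagPart_sub {S Ω : Matrix (Ant nB) (Ant nB) ℂ} (hS : S.PosDef)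
    (hΩ : Ω.PosDef) (T : Finset (Fin NB)) :
    Real.log (blockDiagPart S).det.re - Real.log (mergedCov Ω (blockDiagPart S) T).det.re =
      ∑ i ∈ T, Real.log (block S i i).det.re -
        Real.log (Ω.submatrix (antEmb nB T) (antEmb nB T)).det.re := by
  have hK := posDef_blockDiagPart hS
  set K := blockDiagPart S with hKdef
  have h1 := K.twoBlockTriangular_det (fun p => p.1 ∈ T) (fun p hp q hq => by
    rw [hKdef, blockDiagPart, if_neg]
    rintro h
    exact hp (h ▸ hq))
  have h2 := (mergedCov Ω K T).twoBlockTriangular_det (fun p => p.1 ∈ T) (fun p hp q hq => by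
    rw [mergedCov_apply, if_neg fun h => hp h.1, if_neg fun h => h.2 hq])
  have h3 : (mergedCov Ω K T).toSquareBlockProp (fun p => ¬ p.1 ∈ T) =
      K.toSquareBlockProp (fun p => ¬ p.1 ∈ T) := by
    ext p q
    rw [Matrix.toSquareBlockProp_def, Matrix.toSquareBlockProp_def, Matrix.of_apply,
      Matrix.of_apply, mergedCov_apply, if_neg fun h => p.2 h.1, if_pos ⟨p.2, q.2⟩]
  have h4 : ((mergedCov Ω K T).toSquareBlockProp (fun p => p.1 ∈ T)).det =
      (Ω.submatrix (antEmb nB T) (antEmb nB T)).det := by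
    rw [← Matrix.det_submatrix_equiv_self (antOfEquiv nB T)]
    congr 1
    ext p q
    rw [Matrix.toSquareBlockProp_def, Matrix.submatrix_apply, Matrix.of_apply, mergedCov_apply,
      if_pos ⟨p.1.2, q.1.2⟩]
    rfl
  have h5 : (K.toSquareBlockProp (fun p => p.1 ∈ T)).det = ∏ i ∈ T, (block S i i).det := by
    rw [← Matrix.det_submatrix_equiv_self (antOfEquiv nB T)]
    refine (det_of_blocks (α := {i // i ∈ T}) (m := fun i => Fin (nB i.1)) _ ?_).trans ?_
    rotate_left
    · rw [← Finset.prod_coe_sort T fun i => (block S i i).det]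
      refine Finset.prod_congr rfl fun i _ => ?_
      congr 1
      ext a b
      simp [Matrix.toSquareBlockProp_def, antOfEquiv, antEmb, hKdef, blockDiagPart, block]
    · intro p q hpq
      rw [Matrix.toSquareBlockProp_def, Matrix.submatrix_apply, Matrix.of_apply, hKdef,
        blockDiagPart, if_neg]
      exact fun h => hpq (Subtype.ext h)
  have hpos1 : 0 < (K.toSquareBlockProp (fun p => ¬ p.1 ∈ T)).det :=
    (hK.submatrix (e := Subtype.val) Subtype.val_injective).det_pos
  have hpos2 : 0 < (Ω.submatrix (antEmb nB T) (antEmb nB T)).det :=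
    (hΩ.submatrix (antEmb_injective T)).det_pos
  obtain ⟨hpos3, h6⟩ := log_re_prod T fun i _ => (posDef_block hS i).det_pos
  rw [h1, h2, h3, h4, h5, log_re_mul hpos3 hpos1, log_re_mul hpos2 hpos1, h6]
  ring

theorem selMat_conjTranspose_mulVec (i : Fin NB) (x : Ant nB → ℂ) :
    (selMat nB i)ᴴ *ᵥ x = fun a => x ⟨i, a⟩ := by
  ext a
  simp [Matrix.mulVec, dotProduct, selMat, apply_ite]

theorem selMat_conj (i : Fin NB) (M : Matrix (Ant nB) (Ant nB) ℂ) :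
    (selMat nB i)ᴴ * M * selMat nB i = block M i i := by
  ext a b
  simp [Matrix.mul_apply, selMat, block, apply_ite]

theorem selMatOf_conjTranspose_mulVec (S : Finset (Fin NB)) (x : Ant nB → ℂ) :
    (selMatOf nB S)ᴴ *ᵥ x = fun q => x (antEmb nB S q) := by
  ext a
  simp [Matrix.mulVec, dotProduct, selMatOf, selMat, apply_ite, antEmb]

theorem selMatOf_conj (S : Finset (Fin NB)) (M : Matrix (Ant nB) (Ant nB) ℂ) :
    (selMatOf nB S)ᴴ * M * selMatOf nB S = M.submatrix (antEmb nB S) (antEmb nB S) := by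
  ext a b
  simp [Matrix.mul_apply, selMatOf, selMat, antEmb, apply_ite]

theorem logDetRate_eq (A : Matrix (Ant nB) (Streams r) ℂ) (Ω : Matrix (Ant nB) (Ant nB) ℂ)
    (S : Finset (Fin NB)) :
    logDetRate A Ω S = ∑ i ∈ S, logDet (block (A * Aᴴ + Ω) i i) -
      logDet (Ω.submatrix (antEmb nB S) (antEmb nB S)) := by
  rw [logDetRate, selMatOf_conj]
  congr 1
  refine Finset.sum_congr rfl fun i _ => ?_
  rw [Matrix.mul_assoc _ A, selMat_conj]
  rfl

end Matrices

/-! ### The entropies of the test channel -/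

section Entropies

variable {NB NM : ℕ} {nB : Fin NB → ℕ} {r : Fin NM → ℕ}
  (A : Matrix (Ant nB) (Streams r) ℂ) {Ω : Matrix (Ant nB) (Ant nB) ℂ}

theorem posDef_covariance (hΩ : Ω.PosDef) : (A * Aᴴ + Ω).PosDef :=
  Matrix.PosDef.posSemidef_add (Matrix.posSemidef_self_mul_conjTranspose A) hΩ

theorem map_add_sqLaw (hΩ : Ω.PosDef) {ι : Type} [Fintype ι] [DecidableEq ι]
    (B : Matrix ι (Streams r) ℂ) (B' : Matrix ι (Ant nB) ℂ) :
    (sqLaw r Ω).map (fun ω => B *ᵥ ω.1 + B' *ᵥ ω.2) = CN (B * Bᴴ + B' * Ω * B'ᴴ) := by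
  rw [sqLaw, stdCN_eq_CN, map_add_CN_prod Matrix.PosSemidef.one hΩ.posSemidef, Matrix.mul_one]

theorem map_compressedAt (hΩ : Ω.PosDef) (i : Fin NB) :
    (sqLaw r Ω).map (compressedAt A i) = CN (block (A * Aᴴ + Ω) i i) := by
  have h : compressedAt A i = fun ω : (Streams r → ℂ) × (Ant nB → ℂ) =>
      ((selMat nB i)ᴴ * A) *ᵥ ω.1 + (selMat nB i)ᴴ *ᵥ ω.2 := by
    ext ω a
    rw [← Matrix.mulVec_mulVec, selMat_conjTranspose_mulVec, selMat_conjTranspose_mulVec]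
    rfl
  rw [h, map_add_sqLaw hΩ, ← selMat_conj, Matrix.conjTranspose_mul,
    Matrix.conjTranspose_conjTranspose]
  simp only [Matrix.mul_add, Matrix.add_mul, Matrix.mul_assoc]

/-- Given `x̃ = y`, the compressed signals of the base stations in `S` are Gaussian with mean the
restriction of `y` and covariance the corresponding principal submatrix of `Ω`. -/
theorem condDistrib_compressedOf (hΩ : Ω.PosDef) (S : Finset (Fin NB)) :
    ∀ᵐ y ∂((sqLaw r Ω).map (precoded A)),
      condDistrib (compressedOf A S) (precoded A) (sqLaw r Ω) y =
        (CN (Ω.submatrix (antEmb nB S) (antEmb nB S))).map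
          fun z => (fun q => y (antEmb nB S q)) + z := by
  set R := Ω.submatrix (antEmb nB S) (antEmb nB S) with hR
  have hρ : Measurable fun y : Ant nB → ℂ => fun q => y (antEmb nB S q) := by fun_prop
  have hq : (CN Ω).map (fun y q => y (antEmb nB S q)) = CN R := by
    have h := map_mulVec_CN hΩ.posSemidef (selMatOf nB S)ᴴ
    rw [Matrix.conjTranspose_conjTranspose, selMatOf_conj] at h
    simpa only [selMatOf_conjTranspose_mulVec] using h
  have hadd : Measurable fun p : (Ant nB → ℂ) × (AntOf nB S → ℂ) =>
      (fun q => p.1 (antEmb nB S q)) + p.2 := by fun_prop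
  set κ : Kernel (Ant nB → ℂ) (AntOf nB S → ℂ) :=
    (Kernel.id ×ₖ Kernel.const _ (CN R)).map
      (fun p : (Ant nB → ℂ) × (AntOf nB S → ℂ) => (fun q => p.1 (antEmb nB S q)) + p.2) with hκ
  have hκy : ∀ y, κ y = (CN R).map fun z => (fun q => y (antEmb nB S q)) + z := by
    intro y
    rw [hκ, Kernel.map_apply _ hadd, Kernel.prod_apply, Kernel.id_apply, Kernel.const_apply,
      Measure.dirac_prod, Measure.map_map hadd (by fun_prop)]
    rfl
  have : IsMarkovKernel κ := Kernel.IsMarkovKernel.map _ hadd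
  have hpre : Measurable (precoded A : (Streams r → ℂ) × (Ant nB → ℂ) → Ant nB → ℂ) :=
    (measurable_mulVec A).comp measurable_fst
  have hcomp : Measurable
      (compressedOf A S : (Streams r → ℂ) × (Ant nB → ℂ) → AntOf nB S → ℂ) :=
    hρ.comp (hpre.add measurable_snd)
  have hfst : (sqLaw r Ω).map (precoded A) = sourceLaw A := by
    change (sqLaw r Ω).map ((fun s => A *ᵥ s) ∘ Prod.fst) = _
    rw [← Measure.map_map (measurable_mulVec A) measurable_fst, sqLaw, Measure.map_fst_prod,
      measure_univ, one_smul, sourceLaw]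
  have hκ' : (sqLaw r Ω).map (fun ω => (precoded A ω, compressedOf A S ω)) =
      (sqLaw r Ω).map (precoded A) ⊗ₘ κ := by
    refine Measure.ext_of_lintegral _ fun f hf => ?_
    have h1 : ∀ y, ∫⁻ x, f (y, x) ∂κ y =
        ∫⁻ z, f (y, (fun q => y (antEmb nB S q)) + fun q => z (antEmb nB S q)) ∂CN Ω := by
      intro y
      rw [hκy, ← hq, Measure.map_map (by fun_prop) hρ, lintegral_map (by fun_prop)
        (by fun_prop)]
      rfl
    have hm : Measurable fun y => ∫⁻ x, f (y, x) ∂κ y :=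
      hf.lintegral_kernel_prod_right'
    rw [Measure.lintegral_compProd hf, lintegral_map hf (hpre.prodMk hcomp), hfst, sourceLaw,
      lintegral_map hm (measurable_mulVec A), sqLaw, lintegral_prod _ (by fun_prop)]
    refine lintegral_congr fun s => ?_
    rw [h1]
    rfl
  have h := condDistrib_ae_eq_of_measure_eq_compProd (precoded A) hcomp.aemeasurable hκ'
  filter_upwards [h] with y hy
  rw [hy, hκy]

theorem entropyRateDefined_and_eq (hΩ : Ω.PosDef) (S : Finset (Fin NB)) :
    EntropyRateDefined A Ω S ∧ entropyRate A Ω S = logDetRate A Ω S := by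
  have h1 : ∀ i, HasDiffEntropy ((sqLaw r Ω).map (compressedAt A i)) ∧
      diffEntropy ((sqLaw r Ω).map (compressedAt A i)) =
        nB i * (Real.log Real.pi + 1) / Real.log 2 + logDet (block (A * Aᴴ + Ω) i i) := by
    intro i
    have h := diffEntropy_CN (posDef_block (posDef_covariance A hΩ) i) 0
    simpa [map_compressedAt A hΩ i] using h
  have hR : (Ω.submatrix (antEmb nB S) (antEmb nB S)).PosDef := hΩ.submatrix (antEmb_injective S)
  have h2 := condDistrib_compressedOf A hΩ S
  have h3 : ∀ᵐ y ∂((sqLaw r Ω).map (precoded A)),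
      diffEntropy (condDistrib (compressedOf A S) (precoded A) (sqLaw r Ω) y) =
        Fintype.card (AntOf nB S) * (Real.log Real.pi + 1) / Real.log 2 +
          logDet (Ω.submatrix (antEmb nB S) (antEmb nB S)) := by
    filter_upwards [h2] with y hy
    rw [hy]
    exact (diffEntropy_CN hR _).2
  have hprob : IsProbabilityMeasure ((sqLaw r Ω).map (precoded A)) :=
    Measure.isProbabilityMeasure_map ((measurable_mulVec A).comp measurable_fst).aemeasurable
  refine ⟨⟨fun i _ => (h1 i).1, ?_, (integrable_const _).congr (h3.mono fun y hy => hy.symm)⟩, ?_⟩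
  · filter_upwards [h2] with y hy
    rw [hy]
    exact (diffEntropy_CN hR _).1
  · rw [entropyRate, condDiffEntropy, integral_congr_ae h3, logDetRate_eq]
    have hcard : (Fintype.card (AntOf nB S) : ℝ) = ∑ i ∈ S, (nB i : ℝ) := by
      rw [Fintype.card_sigma, Nat.cast_sum]
      simp only [Fintype.card_fin]
      exact Finset.sum_coe_sort S fun i => (nB i : ℝ)
    simp only [(h1 _).2, Finset.sum_add_distrib, integral_const, probReal_univ, one_smul, hcard,
      Finset.sum_mul, Finset.sum_div]
    ring

end Entropies

/-! ### The partially resampled test channel -/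

section MergedDensity

/-- The density of a Gaussian kernel `u ↦ CN(v u, R)` with respect to `CN(0, K)`. -/
theorem map_shear_withDensity {ι U : Type} [Fintype ι] [DecidableEq ι] [MeasurableSpace U]
    (μ : Measure U) [IsProbabilityMeasure μ] {R K : Matrix ι ι ℂ} (hR : R.PosDef) (hK : K.PosDef)
    {v : U → ι → ℂ} (hv : Measurable v) :
    (μ.prod (CN R)).map (fun p => (p.1, v p.1 + p.2)) =
      (μ.prod (CN K)).withDensity fun z => ENNReal.ofReal
        (Real.exp (logDensityCN R (z.2 - v z.1) - logDensityCN K z.2)) := by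
  have hRm := measurable_logDensityCN R
  have hKm := measurable_logDensityCN K
  have hd : Measurable fun z : U × (ι → ℂ) => ENNReal.ofReal
      (Real.exp (logDensityCN R (z.2 - v z.1) - logDensityCN K z.2)) := by fun_prop
  refine Measure.ext_of_lintegral _ fun f hf => ?_
  rw [lintegral_map hf (by fun_prop), lintegral_withDensity_eq_lintegral_mul _ hd hf,
    lintegral_prod _ (by fun_prop), lintegral_prod _ (by fun_prop)]
  refine lintegral_congr fun u => ?_
  have hm1 : Measurable fun y => f (u, v u + y) := by fun_prop
  have hm2 : Measurable fun x : ι → ℂ => ENNReal.ofReal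
      (Real.exp (logDensityCN R (x - v u) - logDensityCN K x)) * f (u, x) := by fun_prop
  have hm3 : Measurable fun x : ι → ℂ => ENNReal.ofReal (Real.exp (logDensityCN R x)) := by
    fun_prop
  have hm4 : Measurable fun x : ι → ℂ => ENNReal.ofReal (Real.exp (logDensityCN K x)) := by
    fun_prop
  simp only [Pi.mul_apply]
  rw [CN_eq_withDensity hR, CN_eq_withDensity hK,
    lintegral_withDensity_eq_lintegral_mul _ hm3 hm1,
    lintegral_withDensity_eq_lintegral_mul _ hm4 hm2]
  refine Eq.trans ?_ (lintegral_add_left_eq_self _ (v u))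
  refine lintegral_congr fun x => ?_
  simp only [Pi.mul_apply]
  rw [← mul_assoc, ← ENNReal.ofReal_mul (Real.exp_pos _).le, ← Real.exp_add]
  simp

variable {NB NM : ℕ} {nB : Fin NB → ℕ} {r : Fin NM → ℕ}
  (A : Matrix (Ant nB) (Streams r) ℂ) {Ω K : Matrix (Ant nB) (Ant nB) ℂ}

instance : IsProbabilityMeasure (sourceLaw A) :=
  Measure.isProbabilityMeasure_map (measurable_mulVec A).aemeasurable

theorem measurable_testChannel :
    Measurable fun ω : (Streams r → ℂ) × (Ant nB → ℂ) => (precoded A ω, compressed A ω) := by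
  have := measurable_mulVec A
  unfold precoded compressed
  fun_prop

instance : IsProbabilityMeasure (testChannelLaw A Ω) :=
  Measure.isProbabilityMeasure_map (measurable_testChannel A).aemeasurable

theorem sourceLaw_eq_CN : sourceLaw A = CN (A * Aᴴ) := map_mulVec_stdCN A

/-- Replacing the components of `x` outside `T` by those of an independent `CN(0, K)` vector turns
the test channel into `x̃ ↦ D x̃ + z`, where `D` projects onto the antennas of `T` and `z` is
Gaussian with covariance `mergedCov Ω K T`. -/
theorem map_merge_testChannelLaw (hΩ : Ω.PosDef) (hK : K.PosDef) (T : Finset (Fin NB)) :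
    ((testChannelLaw A Ω).prod (CN K)).map
        (fun w => (w.1.1, antProj nB T *ᵥ w.1.2 + antProj nB Tᶜ *ᵥ w.2)) =
      ((sourceLaw A).prod (CN (mergedCov Ω K T))).map
        fun p => (p.1, antProj nB T *ᵥ p.1 + p.2) := by
  have hA := measurable_mulVec A
  have hD := measurable_mulVec (antProj nB T)
  have hD' := measurable_mulVec (antProj nB Tᶜ)
  refine Measure.ext_of_lintegral _ fun f hf => ?_
  have hg : Measurable fun w : ((Ant nB → ℂ) × (Ant nB → ℂ)) × (Ant nB → ℂ) =>
      f (w.1.1, antProj nB T *ᵥ w.1.2 + antProj nB Tᶜ *ᵥ w.2) := by fun_prop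
  rw [lintegral_map hf (by fun_prop), lintegral_map hf (by fun_prop),
    lintegral_prod _ hg.aemeasurable, testChannelLaw,
    lintegral_map hg.lintegral_prod_right' (measurable_testChannel A), sqLaw,
    lintegral_prod _ (by
      exact (hg.lintegral_prod_right'.comp (measurable_testChannel A)).aemeasurable),
    lintegral_prod _ (by fun_prop), sourceLaw, lintegral_map (by
      exact Measurable.lintegral_prod_right' (f := fun p : (Ant nB → ℂ) × (Ant nB → ℂ) =>
        f (p.1, antProj nB T *ᵥ p.1 + p.2)) (by fun_prop)) hA]
  refine lintegral_congr fun s => ?_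
  have hm : Measurable fun z => f (A *ᵥ s, antProj nB T *ᵥ (A *ᵥ s) + z) := by fun_prop
  rw [mergedCov, ← map_add_CN_prod hΩ.posSemidef hK.posSemidef, lintegral_map hm (by fun_prop),
    lintegral_prod _ (by fun_prop)]
  refine lintegral_congr fun q => lintegral_congr fun y => ?_
  simp only [precoded, compressed, Matrix.mulVec_add, add_assoc]

/-- The log-density, given `x̃`, of the vector obtained from `x` by replacing its components
outside `T` by independent copies, with respect to the law `CN(0, K)`. -/
noncomputable def mergedLogDensity (Ω K : Matrix (Ant nB) (Ant nB) ℂ) (T : Finset (Fin NB))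
    (z : (Ant nB → ℂ) × (Ant nB → ℂ)) : ℝ :=
  logDensityCN (mergedCov Ω K T) (z.2 - antProj nB T *ᵥ z.1) - logDensityCN K z.2

theorem measurable_mergedLogDensity (T : Finset (Fin NB)) :
    Measurable (mergedLogDensity Ω K T) := by
  have h1 := measurable_logDensityCN (mergedCov Ω K T)
  have h2 := measurable_logDensityCN K
  have h3 := measurable_mulVec (antProj nB T)
  unfold mergedLogDensity
  fun_prop

theorem map_merge_testChannelLaw_withDensity (hΩ : Ω.PosDef) (hK : K.PosDef)
    (T : Finset (Fin NB)) :
    ((testChannelLaw A Ω).prod (CN K)).map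
        (fun w => (w.1.1, antProj nB T *ᵥ w.1.2 + antProj nB Tᶜ *ᵥ w.2)) =
      ((sourceLaw A).prod (CN K)).withDensity
        fun z => ENNReal.ofReal (Real.exp (mergedLogDensity Ω K T z)) := by
  rw [map_merge_testChannelLaw A hΩ hK,
    map_shear_withDensity _ (posDef_mergedCov hΩ hK T) hK (measurable_mulVec _)]
  rfl

theorem integral_logDensityCN_sub {R : Matrix (Ant nB) (Ant nB) ℂ} (hR : R.PosDef)
    (D : Matrix (Ant nB) (Ant nB) ℂ) :
    Integrable (fun p : (Ant nB → ℂ) × (Ant nB → ℂ) =>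
        logDensityCN R p.2 - logDensityCN K (D *ᵥ p.1 + p.2)) ((sourceLaw A).prod (CN R)) ∧
      ∫ p, (logDensityCN R p.2 - logDensityCN K (D *ᵥ p.1 + p.2)) ∂(sourceLaw A).prod (CN R) =
        Real.log K.det.re - Real.log R.det.re - Fintype.card (Ant nB) +
          (K⁻¹ * (D * (A * Aᴴ) * Dᴴ + R)).trace.re := by
  have hD := measurable_mulVec D
  have hKm := measurable_logDensityCN K
  have hpsd : (D * (A * Aᴴ) * Dᴴ + R).PosSemidef :=
    ((Matrix.posSemidef_self_mul_conjTranspose A).mul_mul_conjTranspose_same _).add hR.posSemidef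
  have hx : ((sourceLaw A).prod (CN R)).map (fun p => D *ᵥ p.1 + p.2) =
      CN (D * (A * Aᴴ) * Dᴴ + R) := by
    have h := map_add_CN_prod (Matrix.posSemidef_self_mul_conjTranspose A) hR.posSemidef D 1
    rw [← sourceLaw_eq_CN] at h
    simpa using h
  have hv : Measurable fun p : (Ant nB → ℂ) × (Ant nB → ℂ) => D *ᵥ p.1 + p.2 := by fun_prop
  obtain ⟨hi1, he1⟩ := integral_logDensityCN (R := K) hpsd
  rw [← hx, integrable_map_measure hKm.aestronglyMeasurable hv.aemeasurable] at hi1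
  rw [← hx, integral_map hv.aemeasurable hKm.aestronglyMeasurable] at he1
  have hi2 : Integrable (fun p : (Ant nB → ℂ) × (Ant nB → ℂ) => logDensityCN R p.2)
      ((sourceLaw A).prod (CN R)) := (integral_logDensityCN hR.posSemidef).1.comp_snd _
  refine ⟨hi2.sub hi1, ?_⟩
  have he2 : ∫ p, logDensityCN R p.2 ∂(sourceLaw A).prod (CN R) =
      ∫ z, logDensityCN R z ∂CN R := by
    rw [integral_fun_snd (logDensityCN R), probReal_univ, one_smul]
  have he3 := integral_sub hi2 hi1
  rw [he2, integral_logDensityCN_self hR] at he3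
  refine he3.trans ?_
  have he4 : ∫ p, (logDensityCN K ∘ fun p => D *ᵥ p.1 + p.2) p ∂(sourceLaw A).prod (CN R) =
      _ := he1
  rw [he4]
  ring

/-- The relative entropy of the merged law is `log 2` times `g_T(A, Ω)`: the quadratic terms of the
two log-densities have the same mean, as `x` and its resampled version have the same diagonal
covariance blocks. -/
theorem integral_mergedLogDensity (hΩ : Ω.PosDef) (hK : K = blockDiagPart (A * Aᴴ + Ω))
    (T : Finset (Fin NB)) :
    Integrable (mergedLogDensity Ω K T) (((sourceLaw A).prod (CN K)).withDensity fun z =>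
        ENNReal.ofReal (Real.exp (mergedLogDensity Ω K T z))) ∧
      ∫ z, mergedLogDensity Ω K T z ∂(((sourceLaw A).prod (CN K)).withDensity fun z =>
          ENNReal.ofReal (Real.exp (mergedLogDensity Ω K T z))) =
        logDetRate A Ω T * Real.log 2 := by
  have hS := posDef_covariance A hΩ
  have hKp : K.PosDef := hK ▸ posDef_blockDiagPart hS
  have hR := posDef_mergedCov hΩ hKp T
  have hD := measurable_mulVec (antProj nB T)
  have hφ : Measurable (mergedLogDensity Ω K T) := measurable_mergedLogDensity T
  have hsh : Measurable fun p : (Ant nB → ℂ) × (Ant nB → ℂ) =>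
      (p.1, antProj nB T *ᵥ p.1 + p.2) := by fun_prop
  have htr : (K⁻¹ * (antProj nB T * (A * Aᴴ) * (antProj nB T)ᴴ + mergedCov Ω K T)).trace =
      Fintype.card (Ant nB) := by
    rw [hK]
    refine trace_inv_blockDiagPart_mul hS fun p q hpq => ?_
    rw [Matrix.add_apply, antProj_conjTranspose, antProj_mul_mul, mergedCov_apply,
      blockDiagPart, if_pos hpq, ← hpq]
    by_cases hp : p.1 ∈ T <;> simp [hp]
  have h3 : ∀ p : (Ant nB → ℂ) × (Ant nB → ℂ),
      mergedLogDensity Ω K T (p.1, antProj nB T *ᵥ p.1 + p.2) =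
        logDensityCN (mergedCov Ω K T) p.2 - logDensityCN K (antProj nB T *ᵥ p.1 + p.2) := by
    intro p
    rw [mergedLogDensity, add_sub_cancel_left]
  obtain ⟨h5, h6⟩ := integral_logDensityCN_sub A (K := K) hR (antProj nB T)
  have h4 := log_det_blockDiagPart_sub hS hΩ T
  rw [← hK] at h4
  rw [← map_merge_testChannelLaw_withDensity A hΩ hKp, map_merge_testChannelLaw A hΩ hKp,
    integrable_map_measure hφ.aestronglyMeasurable hsh.aemeasurable,
    integral_map hsh.aemeasurable hφ.aestronglyMeasurable]
  refine ⟨h5.congr (ae_of_all _ fun p => (h3 p).symm), ?_⟩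
  simp only [h3]
  have hl2 : Real.log 2 ≠ 0 := (Real.log_pos one_lt_two).ne'
  rw [h6, htr, h4, logDetRate_eq]
  simp only [logDet, Real.logb, ← Finset.sum_div, sub_mul, div_mul_cancel₀ _ hl2,
    Complex.natCast_re]
  ring

end MergedDensity

/-! ### Codes for the test channel -/

section Delivery

theorem map_withDensity_comp {X Y : Type*} [MeasurableSpace X] [MeasurableSpace Y]
    (ν : Measure X) {e : X → Y} (he : Measurable e) {g : Y → ℝ≥0∞} (hg : Measurable g) :
    (ν.withDensity fun x => g (e x)).map e = (ν.map e).withDensity g := by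
  ext s hs
  rw [Measure.map_apply he hs, withDensity_apply _ (he hs), withDensity_apply _ hs,
    setLIntegral_map hs hg he]

/-- A measurable encoder: on finitely many indices, a good one can be chosen measurably. -/
theorem exists_measurable_selection {X J : Type*} [MeasurableSpace X] [Finite J] [Nonempty J]
    [MeasurableSpace J] {G : J → Set X} (hG : ∀ j, MeasurableSet (G j)) :
    ∃ f : X → J, Measurable f ∧ ∀ x, (∃ j, x ∈ G j) → x ∈ G (f x) := by
  classical
  let g : (J → Prop) → J := fun p => if h : ∃ j, p j then h.choose else Classical.arbitrary J
  refine ⟨fun x => g fun j => x ∈ G j, (measurable_of_finite g).comp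
    (measurable_pi_lambda _ fun j => (hG j).mem), fun x hx => ?_⟩
  have : g (fun j => x ∈ G j) = Exists.choose hx := dif_pos hx
  change x ∈ G (g fun j => x ∈ G j)
  rw [this]
  exact hx.choose_spec

theorem measurable_cell {ι : Type} [Fintype ι] (Δ : ℝ) :
    Measurable (cell Δ : (ι → ℂ) → ι → ℤ × ℤ) := by
  unfold cell
  fun_prop

theorem measurable_cell₂ {ι : Type} [Fintype ι] (Δ : ℝ) :
    Measurable (cell₂ Δ : (ι → ℂ) × (ι → ℂ) → _) :=
  ((measurable_cell Δ).comp measurable_fst).prodMk ((measurable_cell Δ).comp measurable_snd)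

variable {NB NM : ℕ} {nB : Fin NB → ℕ} {r : Fin NM → ℕ}

/-- Grouping the antennas by base station, `CN(0, K)` with block-diagonal `K` is a product. -/
theorem map_curry_CN {S : Matrix (Ant nB) (Ant nB) ℂ} (hS : S.PosDef) :
    (CN (blockDiagPart S)).map (fun (x : Ant nB → ℂ) i a => x ⟨i, a⟩) =
      Measure.pi fun i => CN (block S i i) := by
  choose V h1 h2 h3 using fun i => exists_CN_eq_map (posDef_block hS i).posSemidef
  have hB : blockDiagPart S = Matrix.blockDiagonal' V * (Matrix.blockDiagonal' V)ᴴ := by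
    rw [Matrix.blockDiagonal'_conjTranspose, ← Matrix.blockDiagonal'_mul,
      blockDiagPart_eq_blockDiagonal']
    simp only [h2, h1]
  have hc : Measurable fun (x : Ant nB → ℂ) (i : Fin NB) (a : Fin (nB i)) => x ⟨i, a⟩ := by
    fun_prop
  have hstd : (stdCN (Ant nB)).map (fun (x : Ant nB → ℂ) i a => x ⟨i, a⟩) =
      Measure.pi fun i => stdCN (Fin (nB i)) := by
    have h := Measure.infinitePi_map_piCurry (ι := Fin NB) (κ := fun i => Fin (nB i))
      (X := fun _ _ => ℂ) fun _ _ => stdComplexNormal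
    simp only [Measure.infinitePi_eq_pi] at h
    exact h
  have hV : Measurable fun (x : ∀ i, Fin (nB i) → ℂ) i => V i *ᵥ x i :=
    measurable_pi_lambda _ fun i => (measurable_mulVec (V i)).comp (measurable_pi_apply i)
  rw [hB, ← map_mulVec_stdCN, Measure.map_map hc (measurable_mulVec _)]
  have hcomp : ((fun (x : Ant nB → ℂ) i a => x ⟨i, a⟩) ∘ fun w => Matrix.blockDiagonal' V *ᵥ w) =
      (fun (x : ∀ i, Fin (nB i) → ℂ) i => V i *ᵥ x i) ∘
        fun (x : Ant nB → ℂ) i a => x ⟨i, a⟩ := by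
    ext w i a
    simp only [Function.comp, Matrix.mulVec, dotProduct]
    rw [Fintype.sum_sigma, Finset.sum_eq_single i]
    · simp only [Matrix.blockDiagonal'_apply_eq]
    · intro j _ hj
      refine Finset.sum_eq_zero fun b _ => ?_
      rw [Matrix.blockDiagonal'_apply_ne _ _ _ hj.symm, zero_mul]
    · simp
  rw [hcomp, ← Measure.map_map hV hc, hstd, Measure.pi_map_pi fun i =>
    (measurable_mulVec (V i)).aemeasurable]
  congr 1
  ext1 i
  exact (h3 i).symm

theorem mergeOn_curry (T : Finset (Fin NB)) (x y : Ant nB → ℂ) :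
    mergeOn T ((fun i a => x ⟨i, a⟩ : ∀ i, Fin (nB i) → ℂ), fun i a => y ⟨i, a⟩) =
      fun i a => (antProj nB T *ᵥ x + antProj nB Tᶜ *ᵥ y) ⟨i, a⟩ := by
  ext i a
  by_cases hi : i ∈ T <;> simp [mergeOn, antProj_mulVec, hi]

/-- Mutual covering for the test channel, with codebooks drawn from the marginals `CN(0, ·)` of the
`x_i`; their product is the law `CN(0, K)` with `K` the block-diagonal part of `A A† + Ω`. -/
theorem exists_codebooks (A : Matrix (Ant nB) (Streams r) ℂ) {Ω : Matrix (Ant nB) (Ant nB) ℂ}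
    (hΩ : Ω.PosDef) {C : Fin NB → ℝ} (hC : ∀ T, logDetRate A Ω T ≤ ∑ i ∈ T, C i) (Δ : ℝ)
    {ε δ : ℝ} (hε : 0 < ε) (hδ : 0 < δ) :
    ∃ n₀ : ℕ, ∀ n ≥ n₀, ∃ M : Fin NB → ℕ, (∀ i, 0 < M i) ∧
      (∀ i, (M i : ℝ) ≤ (2 : ℝ) ^ ((n : ℝ) * C i)) ∧
      ∃ c : Fin n → ∀ i, Fin (M i) → Fin (nB i) → ℂ,
        1 - δ ≤ (Measure.pi fun _ : Fin n => sourceLaw A).real {u | ∃ j : ∀ i, Fin (M i),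
          JointlyTypical (testChannelLaw A Ω) Δ ε u fun t p => c t p.1 (j p.1) p.2} := by
  have hS := posDef_covariance A hΩ
  obtain ⟨K, hK⟩ : ∃ K, K = blockDiagPart (A * Aᴴ + Ω) := ⟨_, rfl⟩
  have hKp : K.PosDef := hK ▸ posDef_blockDiagPart hS
  set Q : ∀ i, Measure (Fin (nB i) → ℂ) := fun i => CN (block (A * Aᴴ + Ω) i i) with hQ
  have hcur : (CN K).map (fun (x : Ant nB → ℂ) i a => x ⟨i, a⟩) = Measure.pi Q := by
    rw [hK]; exact map_curry_CN hS
  have hc : Measurable fun (x : Ant nB → ℂ) (i : Fin NB) (a : Fin (nB i)) => x ⟨i, a⟩ := by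
    fun_prop
  have hD := fun T => measurable_mulVec (antProj nB T)
  -- grouping the antennas by base station
  set e : (Ant nB → ℂ) × (Ant nB → ℂ) → (Ant nB → ℂ) × (∀ i, Fin (nB i) → ℂ) :=
    fun z => (z.1, fun i a => z.2 ⟨i, a⟩) with he
  have hem : Measurable e := by fun_prop
  set e' : (Ant nB → ℂ) × (∀ i, Fin (nB i) → ℂ) → (Ant nB → ℂ) × (Ant nB → ℂ) :=
    fun z => (z.1, fun p => z.2 p.1 p.2) with he'
  have hem' : Measurable e' := by fun_prop
  have hφ : ∀ T, Measurable fun z => mergedLogDensity Ω K T (e' z) := fun T =>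
    (measurable_mergedLogDensity T).comp hem'
  have hmap : ∀ ν : Measure (Ant nB → ℂ), IsProbabilityMeasure ν →
      (ν.prod (CN K)).map e = ν.prod (Measure.pi Q) := by
    intro ν _
    rw [← hcur]
    have h := Measure.map_prod_map ν (CN K) measurable_id hc
    rw [Measure.map_id] at h
    exact h.symm
  have hdens : ∀ T, ((sourceLaw A).prod (Measure.pi Q)).withDensity
      (fun z => ENNReal.ofReal (Real.exp (mergedLogDensity Ω K T (e' z)))) =
      (((sourceLaw A).prod (CN K)).withDensity
        fun z => ENNReal.ofReal (Real.exp (mergedLogDensity Ω K T z))).map e := by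
    intro T
    rw [← hmap _ inferInstance, ← map_withDensity_comp _ hem (by
      have := hφ T
      fun_prop)]
  have hprob : IsProbabilityMeasure ((testChannelLaw A Ω).map e) :=
    Measure.isProbabilityMeasure_map hem.aemeasurable
  have hq : Measurable fun z => cell₂ Δ (e' z) := (measurable_cell₂ Δ).comp hem'
  obtain ⟨n₀, h⟩ := mutual_covering (sourceLaw A) Q ((testChannelLaw A Ω).map e) hφ
    (fun T => by
      have h1 := Measure.map_prod_map (testChannelLaw A Ω) (CN K) hem hc
      have hm : Measurable fun w : ((Ant nB → ℂ) × (∀ i, Fin (nB i) → ℂ)) ×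
          (∀ i, Fin (nB i) → ℂ) => (w.1.1, mergeOn T (w.1.2, w.2)) :=
        (measurable_fst.comp measurable_fst).prodMk ((measurable_mergeOn T).comp (by fun_prop))
      rw [hdens, ← hcur, h1, Measure.map_map hm (hem.prodMap hc),
        ← map_merge_testChannelLaw_withDensity A hΩ hKp, Measure.map_map hem (by
          have h2 := hD T
          have h3 := hD Tᶜ
          fun_prop)]
      congr 1
      ext1 w
      exact Prod.ext rfl (mergeOn_curry T w.1.2 w.2))
    (fun T => by
      rw [hdens, integrable_map_measure (hφ T).aestronglyMeasurable hem.aemeasurable]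
      exact (integral_mergedLogDensity A hΩ hK T).1)
    (C := C) (fun T => by
      rw [hdens, integral_map hem.aemeasurable (hφ T).aestronglyMeasurable]
      refine le_trans (le_of_eq (integral_mergedLogDensity A hΩ hK T).2) ?_
      exact mul_le_mul_of_nonneg_right (hC T) (Real.log_pos one_lt_two).le)
    hq hε hδ
  refine ⟨n₀, fun n hn => ?_⟩
  obtain ⟨M, hM1, hM2, c, hc'⟩ := h n hn
  refine ⟨M, hM1, hM2, c, hc'.trans (le_of_eq ?_)⟩
  congr 1
  ext u
  refine exists_congr fun j => ?_
  have hreal : ∀ k, ((testChannelLaw A Ω).map e).real {z | cell₂ Δ (e' z) = k} =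
      (testChannelLaw A Ω).real {z | cell₂ Δ z = k} := fun k =>
    map_measureReal_apply hem (hq (measurableSet_singleton k))
  simp only [hreal]
  rfl

theorem reliablyTransferable_of_logDetRate_le (A : Matrix (Ant nB) (Streams r) ℂ)
    {Ω : Matrix (Ant nB) (Ant nB) ℂ} (hΩ : Ω.PosDef) {C : Fin NB → ℝ}
    (hC : ∀ T, logDetRate A Ω T ≤ ∑ i ∈ T, C i) : ReliablyTransferable A Ω C := by
  intro Δ _ ε hε δ hδ
  obtain ⟨n₀, h⟩ := exists_codebooks A hΩ hC Δ hε hδ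
  refine ⟨n₀, fun n hn => ?_⟩
  obtain ⟨M, hM1, hM2, c, hc⟩ := h n hn
  have : ∀ i, Nonempty (Fin (M i)) := fun i => ⟨⟨0, hM1 i⟩⟩
  -- typicality depends only on the finitely many cells visited by the block
  have hmeas : ∀ j : ∀ i, Fin (M i), MeasurableSet {u : Fin n → Ant nB → ℂ |
      JointlyTypical (testChannelLaw A Ω) Δ ε u fun t p => c t p.1 (j p.1) p.2} := by
    intro j
    have hm : Measurable fun (u : Fin n → Ant nB → ℂ) (t : Fin n) =>
        cell₂ Δ (u t, fun p : Ant nB => c t p.1 (j p.1) p.2) :=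
      measurable_pi_lambda _ fun t => (measurable_cell₂ Δ).comp (by fun_prop)
    exact hm (Set.to_countable {x : Fin n → (Ant nB → ℤ × ℤ) × (Ant nB → ℤ × ℤ) |
      ∑' k, |(Nat.card {t : Fin n // x t = k} : ℝ) / n -
        (testChannelLaw A Ω).real {z | cell₂ Δ z = k}| ≤ ε}).measurableSet
  obtain ⟨enc, henc, hsel⟩ := exists_measurable_selection hmeas
  refine ⟨⟨M, hM2, fun i m t a => c t i m a, enc, henc⟩, hc.trans (measureReal_mono ?_)⟩
  intro u hu
  exact hsel u hu

end Delivery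

end CloudRAN

theorem lemma2 {NB NM : ℕ} (nB : Fin NB → ℕ) (r : Fin NM → ℕ)
    (A : Matrix (CloudRAN.Ant nB) (CloudRAN.Streams r) ℂ)
    (Ω : Matrix (CloudRAN.Ant nB) (CloudRAN.Ant nB) ℂ) (hΩ : Ω.PosDef) :
    (∀ S : Finset (Fin NB),
      CloudRAN.EntropyRateDefined A Ω S ∧
        CloudRAN.entropyRate A Ω S = CloudRAN.logDetRate A Ω S) ∧
    ∀ C : Fin NB → ℝ,
      (∀ S : Finset (Fin NB), CloudRAN.logDetRate A Ω S ≤ ∑ i ∈ S, C i) →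
        CloudRAN.ReliablyTransferable A Ω C :=
  ⟨fun S => CloudRAN.entropyRateDefined_and_eq A hΩ S,
    fun _ hC => CloudRAN.reliablyTransferable_of_logDetRate_le A hΩ hC⟩
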